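/- Let $A$ be a (not necessarily unital) $C^*$-algebra, viewed as a right Hilbert $C^*$-module $E=A$ over itself with inner product $\langle a,b\rangle=a^*b$. For a state $\omega$ of $A$ let $E^\omega$ be the Hilbert space completion of $A$ modulo null vectors for the scalar product $\omega(\langle x,y\rangle)$, and let $\iota_\omega:A\to E^\omega$ be the natural map. For a representation $(\pi,H_\pi)$ of $A$ let $E\hat\otimes_A H_\pi$ be the interior tensor product, i.e. the Hilbert space completion for $\langle x\otimes h,x'\otimes h'\rangle=\langle h,\pi(\langle x,x'\rangle)h'\rangle$. An operator $T$ in $E$, defined on a dense $A$-submodule $\operatorname{dom}(T)$ of $E$, is called semiregular if its adjoint $T^*$ (with respect to $\langle\cdot,\cdot\rangle$) is densely defined; a closed semiregular $T$ is called regular if $I+T^*T$ has dense range. For semiregular $T$ the localizations $T^\omega$ in $E^\omega$ and $T^\pi$ in $E\hat\otimes_AH_\pi$ are the closures of the operators $\iota_\omega(x)\mapsto\iota_\omega(Tx)$ with domain $\iota_\omega(\operatorname{dom}(T))$, and $x\otimes h\mapsto (Tx)\otimes h$ with domain spanned by the $x\otimes h$, $x\in\operatorname{dom}(T)$, $h\in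 H_\pi$. (a) For every closed proper submodule (closed proper right ideal) $L\subsetneq A$ there is a pure state $\omega$ of $A$ such that $\iota_\omega(L)$ is not dense in $E^\omega$, and hence $\iota_\omega(L)^\perp\neq\{0\}$. (b) For a closed semiregular operator $T$ in $E=A$ the following are equivalent: (1) $T$ is regular; (2) for every representation $(\pi,H_\pi)$ of $A$ the localizations $T^\pi$ and $(T^*)^\pi$ are adjoints of each other, i.e. $(T^*)^\pi=(T^\pi)^*$; (3) for every pure state $\omega$ of $A$ the localizations $T^\omega$ and $(T^*)^\omega$ are adjoints of each other, i.e. $(T^*)^\omega=(T^\omega)^*$. (c) For a closed, densely defined and symmetric operator $T$ in $E=A$ (with domain an $A$-submodule) the following are equivalent: (1) $T$ is selfadjoint and regular; (2) for every representation $(\pi,H_\pi)$ of $A$ the localization $T^\pi$ is selfadjoint; (3) for every pure state $\omega$ of $A$ the localization $T^\omega$ is selfadjoint. -/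

import Mathlib

open scoped ComplexOrder InnerProductSpace TensorProduct

universe u

noncomputable section

namespace CStarLoc

/-! Throughout, a C*-algebra `A` (not necessarily unital) is regarded as a right Hilbert C*-module
over itself: `A` acts by right multiplication and the `A`-valued inner product is
`⟨a, b⟩ = star a * b`. -/

section Module

variable {A : Type*} [NonUnitalCStarAlgebra A]

/-- The `A`-valued inner product of the right Hilbert module `A`: conjugate linear in the first,
linear in the second variable. -/
def ip (a b : A) : A := star a * b

/-- A linear subspace of `A` is an `A`-submodule of the right module `A` (a right ideal). -/
def IsRightSubmodule (L : Submodule ℂ A) : Prop :=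
  ∀ x ∈ L, ∀ a : A, x * a ∈ L

/-- The graph of the adjoint of the unbounded operator `T` in the Hilbert module `A`: all pairs
`(y, z)` with `⟨T x, y⟩ = ⟨x, z⟩` for all `x` in the domain of `T`. -/
def adjointGraph (T : A →ₗ.[ℂ] A) : Submodule ℂ (A × A) where
  carrier := {p | ∀ x : T.domain, ip (T x) p.1 = ip (x : A) p.2}
  add_mem' := by
    intro p q hp hq x
    have h1 := hp x
    have h2 := hq x
    simp only [ip] at h1 h2 ⊢
    simp [mul_add, h1, h2]
  zero_mem' := by
    intro x
    simp [ip]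
  smul_mem' := by
    intro c p hp x
    have h1 := hp x
    simp only [ip] at h1 ⊢
    simp [mul_smul_comm, h1]

/-- The adjoint `T*` of an unbounded operator `T` in the Hilbert module `A` (meaningful when `T` is
densely defined, see `mem_adjointGraph_fst_eq_zero`): `y` is in its domain iff there is a `z` with
`⟨T x, y⟩ = ⟨x, z⟩` for all `x` in the domain of `T`, and then `T* y = z`. -/
def adj (T : A →ₗ.[ℂ] A) : A →ₗ.[ℂ] A := (adjointGraph T).toLinearPMap

/-- If `T` is densely defined, `adjointGraph T` is the graph of an operator. -/
theorem mem_adjointGraph_fst_eq_zero {T : A →ₗ.[ℂ] A} (hT : Dense (T.domain : Set A))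
    (p : A × A) (hp : p ∈ adjointGraph T) (h0 : p.1 = 0) : p.2 = 0 := by
  have h : ∀ x : A, star x * p.2 = 0 := by
    intro x
    refine hT.induction (P := fun x => star x * p.2 = 0) ?_ ?_ x
    · intro y hy
      have := hp ⟨y, hy⟩
      simpa [ip, h0] using this.symm
    · exact isClosed_eq (by fun_prop) continuous_const
  exact CStarRing.star_mul_self_eq_zero_iff _ |>.1 (h p.2)

/-- For a densely defined `T` the graph of `T*` is as expected. -/
theorem mem_graph_adj {T : A →ₗ.[ℂ] A} (hT : Dense (T.domain : Set A)) (y z : A) :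
    (y, z) ∈ (adj T).graph ↔ ∀ x : T.domain, ip (T x) y = ip (x : A) z := by
  rw [adj, Submodule.toLinearPMap_graph_eq _ (fun p => mem_adjointGraph_fst_eq_zero hT p)]
  rfl

/-- An operator in the Hilbert module `A`, defined on a dense `A`-submodule. -/
structure IsDenselyDefined (T : A →ₗ.[ℂ] A) : Prop where
  dense : Dense (T.domain : Set A)
  submodule : IsRightSubmodule T.domain

/-- Semiregular operators: defined on a dense `A`-submodule and with densely defined adjoint. -/
structure IsSemiregular (T : A →ₗ.[ℂ] A) : Prop extends IsDenselyDefined T where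
  dense_adj : Dense ((adj T).domain : Set A)

/-- The range of `I + T* T`, whose domain consists of the `x ∈ dom T` with `T x ∈ dom T*`. -/
def rangeOneAdd (T : A →ₗ.[ℂ] A) : Set A :=
  {w | ∃ (x : T.domain) (hx : T x ∈ (adj T).domain), w = (x : A) + adj T ⟨T x, hx⟩}

/-- Regular operators: closed semiregular operators such that `I + T* T` has dense range. -/
structure IsRegular (T : A →ₗ.[ℂ] A) : Prop extends IsSemiregular T where
  closed : T.IsClosed
  dense_range : Dense (rangeOneAdd T)

end Module

section State

variable {A : Type*} [NonUnitalCStarAlgebra A] [PartialOrder A] [StarOrderedRing A]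

/-- A positive linear functional as a continuous linear functional (positive linear functionals on a
C*-algebra are automatically continuous). -/
def toDual (ω : A →ₚ[ℂ] ℂ) : StrongDual ℂ A :=
  ⟨ω.toLinearMap, map_continuous ω⟩

/-- States: positive linear functionals of norm one. -/
def IsState (ω : A →ₚ[ℂ] ℂ) : Prop := ‖toDual ω‖ = 1

variable (A) in
/-- The set of states, in the dual space. -/
def stateSpace : Set (StrongDual ℂ A) := {φ | ∃ ω : A →ₚ[ℂ] ℂ, IsState ω ∧ toDual ω = φ}

/-- Pure states: the extreme points of the convex set of states. -/
def IsPureState (ω : A →ₚ[ℂ] ℂ) : Prop := toDual ω ∈ (stateSpace A).extremePoints ℝ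

/-- The natural map `ι_ω : A → A^ω`. Here `A^ω = ω.GNS` is the Hilbert space completion of `A`
(modulo null vectors) with respect to the scalar product `ω ⟨x, y⟩ = ω (star x * y)`. -/
def iota (ω : A →ₚ[ℂ] ℂ) : A →ₗ[ℂ] ω.GNS :=
  (UniformSpace.Completion.toComplₗᵢ (𝕜 := ℂ) (E := ω.PreGNS)).toLinearMap ∘ₗ
    ω.toPreGNS.toLinearMap

theorem inner_iota (ω : A →ₚ[ℂ] ℂ) (x y : A) :
    ⟪iota ω x, iota ω y⟫_ℂ = ω (ip x y) := by
  change ⟪((ω.toPreGNS x : ω.PreGNS) : ω.GNS), ((ω.toPreGNS y : ω.PreGNS) : ω.GNS)⟫_ℂ = _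
  rw [UniformSpace.Completion.inner_coe]
  rfl

/-- The operator `T₀^ω` in `A^ω`, with domain `ι_ω (dom T)` and `T₀^ω (ι_ω x) = ι_ω (T x)`, given
by its graph. -/
def preLocState (ω : A →ₚ[ℂ] ℂ) (T : A →ₗ.[ℂ] A) : ω.GNS →ₗ.[ℂ] ω.GNS :=
  (T.graph.map ((iota ω).prodMap (iota ω))).toLinearPMap

/-- The localization `T^ω` of `T` with respect to the state `ω`: the closure of `T₀^ω`. -/
def locState (ω : A →ₚ[ℂ] ℂ) (T : A →ₗ.[ℂ] A) : ω.GNS →ₗ.[ℂ] ω.GNS :=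
  (preLocState ω T).closure

end State

section Representation

variable {A : Type*} [NonUnitalCStarAlgebra A]
  {H : Type*} [NormedAddCommGroup H] [InnerProductSpace ℂ H] [CompleteSpace H]

/-- The algebraic tensor product `A ⊗ H`, equipped below with the semi-inner product determined by
`⟨a ⊗ h, b ⊗ k⟩ = ⟨h, π ⟨a, b⟩ k⟩`. -/
def PreTensor (_π : A →⋆ₙₐ[ℂ] (H →L[ℂ] H)) : Type _ := A ⊗[ℂ] H

variable (π : A →⋆ₙₐ[ℂ] (H →L[ℂ] H))

instance : AddCommGroup (PreTensor π) := inferInstanceAs (AddCommGroup (A ⊗[ℂ] H))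
instance : Module ℂ (PreTensor π) := inferInstanceAs (Module ℂ (A ⊗[ℂ] H))

/-- The elementary tensor `a ⊗ h`. -/
def tmul (a : A) (h : H) : PreTensor π := a ⊗ₜ[ℂ] h

/-- The linear map `A ⊗ H → H`, `a ⊗ h ↦ π a h`. -/
def evalMap : PreTensor π →ₗ[ℂ] H :=
  TensorProduct.lift (LinearMap.mk₂ ℂ (fun (a : A) (h : H) => π a h)
    (by intros; simp) (by intros; simp) (by intros; simp) (by intros; simp))

/-- The semi-inner product on `A ⊗ H`; see `inner_tmul` for its values on elementary tensors. -/
abbrev preTensorCore : PreInnerProductSpace.Core ℂ (PreTensor π) where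
  inner s t := ⟪evalMap π s, evalMap π t⟫_ℂ
  conj_inner_symm s t := by simp
  re_inner_nonneg s := inner_self_nonneg
  add_left s t r := by simp
  smul_left s t c := by simp [mul_comm]

instance : SeminormedAddCommGroup (PreTensor π) :=
  InnerProductSpace.Core.toSeminormedAddCommGroup (c := preTensorCore π)
instance : InnerProductSpace ℂ (PreTensor π) :=
  InnerProductSpace.ofCore (preTensorCore π)

/-- The defining formula of the interior tensor product. -/
theorem inner_tmul (a b : A) (h k : H) :
    ⟪tmul π a h, tmul π b k⟫_ℂ = ⟪h, π (ip a b) k⟫_ℂ := by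
  change ⟪π a h, π b k⟫_ℂ = _
  rw [ip, map_mul, map_star, ContinuousLinearMap.star_eq_adjoint, mul_apply_eq_comp,
    ContinuousLinearMap.adjoint_inner_right]

/-- The interior tensor product of the Hilbert module `A` with `H` over `A`: the Hilbert space
completion of `A ⊗ H` (modulo null vectors). It is the localization of the Hilbert module `A` with
respect to the representation `π`. -/
abbrev IntTensor : Type _ := UniformSpace.Completion (PreTensor π)

/-- The elementary tensor `a ⊗ h` in the interior tensor product. -/
def itmul (a : A) (h : H) : IntTensor π := ((tmul π a h : PreTensor π) : IntTensor π)

/-- The operator `T₀^π` in the interior tensor product whose domain is the span of the `x ⊗ h` with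
`x ∈ dom T` and `h ∈ H`, and with `T₀^π (x ⊗ h) = (T x) ⊗ h`, given by its graph. -/
def preLocRep (T : A →ₗ.[ℂ] A) : IntTensor π →ₗ.[ℂ] IntTensor π :=
  (Submodule.span ℂ {p : IntTensor π × IntTensor π |
    ∃ (x : T.domain) (h : H), p = (itmul π (x : A) h, itmul π (T x) h)}).toLinearPMap

/-- The localization `T^π` of `T` with respect to the representation `π`: the closure of `T₀^π`. -/
def locRep (T : A →ₗ.[ℂ] A) : IntTensor π →ₗ.[ℂ] IntTensor π :=
  (preLocRep π T).closure

end Representation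

end CStarLoc

end

/-! Everything reduces to density of one right submodule of `A × A`. Rotate the graph of `T` by a
quarter turn and add the graph of `T*`. In a Hilbert space, the closures of two formally adjoint
operators are adjoint to each other exactly when this orthogonal sum of graphs is dense
(`adjoint_closure_eq_iff`). In the module itself, density of the sum characterizes regularity: for
closed graphs the sum is closed, so density makes it everything, and splitting `(0, -w)` solves `(I
+ T*T) x = w` (`isRegular_iff_dense_graphSum`). Localization commutes with forming the sum.

What remains is that a right submodule `S` is dense once its localizations at pure states are
(`dense_of_forall_pureState`). For fixed `y`, let `sqDist` send a quasi-state `φ` to the infimum of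
`φ(|y - s|²)` over `s ∈ S`. Two approximants of `y` can be merged into one that is nearly as good as
both for all `φ` simultaneously (`exists_sqAbs_le_of_quasiState`). Hence `sqDist` is convex, and by
compactness it vanishes identically only if `y` lies in the closure of `S`. Otherwise its maximum is
positive and attained, the maximizers form a compact face of the quasi-states, and Krein–Milman
gives an extreme point there. This point is nonzero, so it is a pure state separating `y` from `S`.
Taking `S = L × A` gives part (a).

Arbitrary representations enter through two easy implications: density passes to every interior
tensor product, and the GNS representation leads back to the localization at a state. -/

noncomputable section

namespace CStarLoc

/-! ### Rotated graph sums. -/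

section Graphs

/-- For graphs `D`, `D'` of operators, the sum of `D'` and of the rotation of `D` by a quarter
turn. If `D` is closed and `D'` is the graph of the adjoint, then the two summands are orthogonal. -/
def graphSum {E : Type*} [AddCommGroup E] [Module ℂ E] (D D' : Submodule ℂ (E × E)) :
    Submodule ℂ (E × E) :=
  D.map (LinearEquiv.skewSwap ℂ E E).symm.toLinearMap ⊔ D'

theorem mem_graphSum {E : Type*} [AddCommGroup E] [Module ℂ E] {D D' : Submodule ℂ (E × E)}
    {s : E × E} :
    s ∈ graphSum D D' ↔ ∃ p ∈ D, ∃ q ∈ D', (p.2 + q.1, -p.1 + q.2) = s := by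
  simp only [graphSum, Submodule.mem_sup, Submodule.mem_map]
  constructor
  · rintro ⟨_, ⟨p, hp, rfl⟩, q, hq, rfl⟩
    exact ⟨p, hp, q, hq, rfl⟩
  · rintro ⟨p, hp, q, hq, rfl⟩
    exact ⟨_, ⟨p, hp, rfl⟩, q, hq, rfl⟩

theorem map_graphSum {E F : Type*} [AddCommGroup E] [Module ℂ E] [AddCommGroup F] [Module ℂ F]
    (f : E →ₗ[ℂ] F) (D D' : Submodule ℂ (E × E)) :
    (graphSum D D').map (f.prodMap f) =
      graphSum (D.map (f.prodMap f)) (D'.map (f.prodMap f)) := by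
  rw [graphSum, graphSum, Submodule.map_sup, ← Submodule.map_comp, ← Submodule.map_comp]
  congr 2
  ext x <;> simp

end Graphs

/-! ### Formally adjoint operators in a Hilbert space. -/

section Hilbert

variable {X : Type*} [NormedAddCommGroup X] [InnerProductSpace ℂ X] [CompleteSpace X]

/-- Density means `Mᗮ ⊓ Nᗮ = ⊥`. Since `Nᗮᗮ ≤ Mᗮ`, projecting a vector of `Mᗮ` onto `Nᗮᗮ` leaves a
remainder in this intersection. -/
theorem dense_sup_iff_orthogonal_eq_closure {M N : Submodule ℂ X} (h : M ⟂ N) :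
    Dense ((M ⊔ N : Submodule ℂ X) : Set X) ↔ Mᗮ = N.topologicalClosure := by
  rw [Submodule.dense_iff_topologicalClosure_eq_top, Submodule.topologicalClosure_eq_top_iff,
    ← Submodule.inf_orthogonal, ← Submodule.orthogonal_orthogonal_eq_closure]
  constructor
  · intro h0
    refine le_antisymm (fun x hx => ?_) ?_
    · have h1 : x - Nᗮᗮ.starProjection x ∈ Nᗮ := by
        have := Submodule.sub_starProjection_mem_orthogonal (K := Nᗮᗮ) x
        rwa [Submodule.triorthogonal_eq_orthogonal] at this
      have h2 : Nᗮᗮ.starProjection x ∈ Nᗮᗮ := Submodule.starProjection_apply_mem _ _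
      have h3 : Nᗮᗮ ≤ Mᗮ := Submodule.orthogonal_le h
      have h4 : x - Nᗮᗮ.starProjection x ∈ Mᗮ ⊓ Nᗮ := ⟨sub_mem hx (h3 h2), h1⟩
      rw [h0, Submodule.mem_bot, sub_eq_zero] at h4
      rwa [h4]
    · exact Submodule.orthogonal_le h
  · intro h0
    rw [h0, inf_comm]
    exact Submodule.inf_orthogonal_eq_bot _

/-- `D` and `D'` are the graphs of formally adjoint densely defined operators. -/
structure IsFormalAdjointPair (D D' : Submodule ℂ (X × X)) : Prop where
  inner_eq : ∀ p ∈ D, ∀ q ∈ D', ⟪p.2, q.1⟫_ℂ = ⟪p.1, q.2⟫_ℂ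
  dense_left : Dense (D.map (LinearMap.fst ℂ X X) : Set X)
  dense_right : Dense (D'.map (LinearMap.fst ℂ X X) : Set X)

namespace IsFormalAdjointPair

variable {D D' : Submodule ℂ (X × X)}

omit [CompleteSpace X] in
theorem symm (h : IsFormalAdjointPair D D') : IsFormalAdjointPair D' D where
  inner_eq p hp q hq := by
    rw [← inner_conj_symm, ← h.inner_eq q hq p hp, inner_conj_symm]
  dense_left := h.dense_right
  dense_right := h.dense_left

omit [CompleteSpace X] in
theorem snd_eq_zero (h : IsFormalAdjointPair D D') (p : X × X) (hp : p ∈ D.topologicalClosure)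
    (h0 : p.1 = 0) : p.2 = 0 := by
  refine h.dense_right.eq_zero_of_inner_left ℂ ?_
  rintro _ ⟨q, hq, rfl⟩
  have key : ⟪p.2, q.1⟫_ℂ = ⟪p.1, q.2⟫_ℂ := by
    have hc : IsClosed {p : X × X | ⟪p.2, q.1⟫_ℂ = ⟪p.1, q.2⟫_ℂ} :=
      isClosed_eq (by fun_prop) (by fun_prop)
    exact closure_minimal (fun r hr => h.inner_eq r hr q hq) hc hp
  simpa [h0] using key

omit [CompleteSpace X] in
theorem graph_toLinearPMap (h : IsFormalAdjointPair D D') : D.toLinearPMap.graph = D :=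
  Submodule.toLinearPMap_graph_eq _
    fun p hp => h.snd_eq_zero p (D.le_topologicalClosure hp)

omit [CompleteSpace X] in
theorem graph_closure (h : IsFormalAdjointPair D D') :
    D.toLinearPMap.closure.graph = D.topologicalClosure := by
  have hc : D.toLinearPMap.IsClosable :=
    ⟨D.topologicalClosure.toLinearPMap, by
      rw [h.graph_toLinearPMap, Submodule.toLinearPMap_graph_eq _ h.snd_eq_zero]⟩
  rw [← hc.graph_closure_eq_closure_graph, h.graph_toLinearPMap]

omit [CompleteSpace X] in
theorem dense_domain_closure (h : IsFormalAdjointPair D D') :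
    Dense (D.toLinearPMap.closure.domain : Set X) :=
  h.dense_left.mono (D.toLinearPMap.le_closure.1)

omit [CompleteSpace X] in
theorem topologicalClosure_adjoint (D : Submodule ℂ (X × X)) :
    D.topologicalClosure.adjoint = D.adjoint := by
  ext q
  simp only [Submodule.mem_adjoint_iff]
  refine ⟨fun H a b hab => H a b (D.le_topologicalClosure hab), fun H a b hab => ?_⟩
  have hc : IsClosed {p : X × X | ⟪p.2, q.1⟫_ℂ - ⟪p.1, q.2⟫_ℂ = 0} :=
    isClosed_eq (by fun_prop) (by fun_prop)
  exact closure_minimal (fun r hr => H r.1 r.2 hr) hc hab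

/-- The graph of the adjoint is the orthogonal complement of the rotated graph. The plain product
carries the sup norm, so orthogonality is expressed in `WithLp 2`. -/
theorem adjoint_eq_iff_dense (h : IsFormalAdjointPair D D') :
    D.adjoint = D'.topologicalClosure ↔ Dense (graphSum D D' : Set (X × X)) := by
  let e := (WithLp.prodContinuousLinearEquiv 2 ℂ X X).symm
  let M := (D.map (LinearEquiv.skewSwap ℂ X X).symm.toLinearMap).map (e : X × X →ₗ[ℂ] WithLp 2 (X × X))
  let N := D'.map (e : X × X →ₗ[ℂ] WithLp 2 (X × X))
  have hMN : M ⟂ N := by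
    rw [Submodule.isOrtho_iff_inner_eq]
    rintro _ ⟨_, ⟨p, hp, rfl⟩, rfl⟩ _ ⟨q, hq, rfl⟩
    have := h.inner_eq p hp q hq
    change ⟪WithLp.toLp 2 (p.2, -p.1), WithLp.toLp 2 q⟫_ℂ = 0
    simp [WithLp.prod_inner_apply, this]
  have hdense : Dense (graphSum D D' : Set (X × X)) ↔
      Dense ((M ⊔ N : Submodule ℂ (WithLp 2 (X × X))) : Set (WithLp 2 (X × X))) := by
    rw [← Submodule.map_sup, Submodule.map_coe]
    refine ⟨fun H => e.surjective.denseRange.dense_image e.continuous H, fun H => ?_⟩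
    have := H.preimage e.toHomeomorph.isOpenMap
    exact (Set.preimage_image_eq (graphSum D D' : Set (X × X)) e.injective) ▸ this
  have hadj : ∀ q, q ∈ D.adjoint ↔ e q ∈ Mᗮ := by
    intro q
    simp only [Submodule.mem_adjoint_iff, Submodule.mem_orthogonal]
    constructor
    · rintro H _ ⟨_, ⟨p, hp, rfl⟩, rfl⟩
      change ⟪WithLp.toLp 2 (p.2, -p.1), WithLp.toLp 2 q⟫_ℂ = 0
      simpa [WithLp.prod_inner_apply, ← sub_eq_add_neg] using H p.1 p.2 hp
    · intro H a b hab
      have h1 : ⟪WithLp.toLp 2 (b, -a), WithLp.toLp 2 q⟫_ℂ = 0 :=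
        H _ ⟨_, ⟨(a, b), hab, rfl⟩, rfl⟩
      simpa [WithLp.prod_inner_apply, ← sub_eq_add_neg] using h1
  have hcl : ∀ q, q ∈ D'.topologicalClosure ↔ e q ∈ N.topologicalClosure := by
    intro q
    have h1 : e '' closure (D' : Set (X × X)) = closure (e '' (D' : Set (X × X))) :=
      e.toHomeomorph.image_closure _
    change q ∈ closure (D' : Set (X × X)) ↔ e q ∈ closure (e '' (D' : Set (X × X)))
    rw [← h1, e.injective.mem_set_image]
  rw [hdense, dense_sup_iff_orthogonal_eq_closure hMN]
  constructor
  · intro H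
    ext x
    obtain ⟨q, rfl⟩ := e.surjective x
    rw [← hadj, ← hcl, H]
  · intro H
    ext q
    rw [hadj, hcl, H]

/-- The closures of formally adjoint operators are adjoint to each other iff their graphs span a
dense subspace. -/
theorem adjoint_closure_eq_iff (h : IsFormalAdjointPair D D') :
    D.toLinearPMap.closure.adjoint = D'.toLinearPMap.closure ↔
      Dense (graphSum D D' : Set (X × X)) := by
  rw [← h.adjoint_eq_iff_dense, ← topologicalClosure_adjoint, ← h.graph_closure,
    ← LinearPMap.adjoint_graph_eq_graph_adjoint h.dense_domain_closure, ← h.symm.graph_closure]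
  exact ⟨fun H => by rw [H], LinearPMap.eq_of_eq_graph⟩

end IsFormalAdjointPair

end Hilbert

/-! ### Functionals and resolvents in unital C*-algebras. -/

section Unital

variable {B : Type*} [CStarAlgebra B] [PartialOrder B] [StarOrderedRing B]

theorem one_add_norm_le_norm_one_add [Nontrivial B] {a : B} (ha : 0 ≤ a) : 1 + ‖a‖ ≤ ‖1 + a‖ := by
  have h0 : (0 : B) ≤ 1 + a := add_nonneg zero_le_one ha
  have h1 : (1 : ℝ) ≤ ‖1 + a‖ := by
    have := CStarAlgebra.norm_le_norm_of_nonneg_of_le (a := (1 : B)) (b := 1 + a) zero_le_one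
      (le_add_of_nonneg_right ha)
    simpa using this
  have h2 : a ≤ algebraMap ℝ B (‖1 + a‖ - 1) := by
    have := (CStarAlgebra.norm_le_iff_le_algebraMap (1 + a) (norm_nonneg _) h0).1 le_rfl
    rw [map_sub, map_one]
    exact le_sub_iff_add_le'.2 this
  have := (CStarAlgebra.norm_le_iff_le_algebraMap a (sub_nonneg.2 h1) ha).2 h2
  linarith

/-- The element `‖b‖ - b` has norm at most `‖b‖`, so `f` cannot send it beyond `‖b‖`. -/
theorem re_nonneg_of_map_one {f : StrongDual ℂ B} (hf : ‖f‖ ≤ 1) (h1 : f 1 = 1) {b : B}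
    (hb : 0 ≤ b) : 0 ≤ (f b).re := by
  have h2 : ‖algebraMap ℝ B ‖b‖ - b‖ ≤ ‖b‖ := by
    have hle := (CStarAlgebra.norm_le_iff_le_algebraMap b (norm_nonneg _) hb).1 le_rfl
    refine (CStarAlgebra.norm_le_iff_le_algebraMap _ (norm_nonneg _) (sub_nonneg.2 hle)).2 ?_
    exact sub_le_self _ hb
  have h3 : f (algebraMap ℝ B ‖b‖) = (‖b‖ : ℂ) := by
    rw [Algebra.algebraMap_eq_smul_one, ← Complex.coe_smul, map_smul, h1]
    simp
  have h4 : (f (algebraMap ℝ B ‖b‖ - b)).re ≤ ‖b‖ :=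
    (Complex.re_le_norm _).trans ((f.le_of_opNorm_le hf _).trans (by simpa using h2))
  rw [map_sub, h3] at h4
  simp only [Complex.sub_re, Complex.ofReal_re] at h4
  linarith

-- Shifting `b` by `i n` moves the imaginary part linearly in `n`, while `‖b + i n‖² ≤ ‖b‖² + n²`.
-- Large `|n|` of the right sign contradicts a nonzero imaginary part.
omit [PartialOrder B] [StarOrderedRing B] in
theorem im_eq_zero_of_map_one {f : StrongDual ℂ B} (hf : ‖f‖ ≤ 1) (h1 : f 1 = 1) {b : B}
    (hb : IsSelfAdjoint b) : (f b).im = 0 := by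
  have key : ∀ n : ℝ, ((f b).im + n) ^ 2 ≤ ‖b‖ ^ 2 + n ^ 2 * ‖(1 : B)‖ := by
    intro n
    have e1 : star (b + (n * Complex.I : ℂ) • (1 : B)) * (b + (n * Complex.I : ℂ) • (1 : B)) =
        star b * b + ((n : ℂ) ^ 2) • (1 : B) := by
      simp only [star_add, star_smul, star_one, hb.star_eq, add_mul, mul_add, smul_mul_assoc,
        one_mul, mul_smul_comm, mul_one, Complex.star_def, map_mul, Complex.conj_ofReal,
        Complex.conj_I]
      have : (n : ℂ) * Complex.I * (n * -Complex.I) = (n : ℂ) ^ 2 := by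
        linear_combination (-(n : ℂ) ^ 2) * Complex.I_mul_I
      rw [smul_add, smul_smul, this, mul_neg, neg_smul]
      abel
    have e2 : ‖b + (n * Complex.I : ℂ) • (1 : B)‖ ^ 2 ≤ ‖b‖ ^ 2 + n ^ 2 * ‖(1 : B)‖ := by
      rw [sq, ← CStarRing.norm_star_mul_self, e1]
      refine (norm_add_le _ _).trans ?_
      rw [CStarRing.norm_star_mul_self, norm_smul, ← sq]
      simp
    have e3 : f (b + (n * Complex.I : ℂ) • (1 : B)) = f b + n * Complex.I := by
      rw [map_add, map_smul, h1, smul_eq_mul, mul_one]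
    have e4 : ((f b).im + n) ≤ ‖b + (n * Complex.I : ℂ) • (1 : B)‖ ∧
        -((f b).im + n) ≤ ‖b + (n * Complex.I : ℂ) • (1 : B)‖ := by
      have h5 := f.le_of_opNorm_le hf (b + (n * Complex.I : ℂ) • (1 : B))
      have h6 := Complex.abs_im_le_norm (f (b + (n * Complex.I : ℂ) • (1 : B)))
      rw [e3] at h5 h6
      have h7 : (f b + n * Complex.I).im = (f b).im + n := by simp
      rw [h7] at h6
      rw [one_mul] at h5
      exact ⟨(le_abs_self _).trans (h6.trans h5), (neg_le_abs _).trans (h6.trans h5)⟩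
    refine le_trans ?_ e2
    exact sq_le_sq' (by linarith [e4.2]) e4.1
  have hone : ‖(1 : B)‖ ≤ 1 := by
    rcases subsingleton_or_nontrivial B with _ | _
    · simp [Subsingleton.elim (1 : B) 0]
    · simp
  have key' : ∀ n : ℝ, (f b).im ^ 2 + 2 * (f b).im * n ≤ ‖b‖ ^ 2 := by
    intro n
    have := key n
    have h8 : n ^ 2 * ‖(1 : B)‖ ≤ n ^ 2 * 1 := by gcongr
    nlinarith
  by_contra h0
  have := key' ((‖b‖ ^ 2 + 1) / (2 * (f b).im))
  have h9 : 2 * (f b).im * ((‖b‖ ^ 2 + 1) / (2 * (f b).im)) = ‖b‖ ^ 2 + 1 := by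
    field_simp
  nlinarith [sq_nonneg (f b).im]

theorem nonneg_of_map_one {f : StrongDual ℂ B} (hf : ‖f‖ ≤ 1) (h1 : f 1 = 1) {b : B}
    (hb : 0 ≤ b) : 0 ≤ f b := by
  rw [Complex.nonneg_iff]
  exact ⟨re_nonneg_of_map_one hf h1 hb, (im_eq_zero_of_map_one hf h1 (.of_nonneg hb)).symm⟩

/-- The norm of a positive element is attained at a state. -/
theorem exists_map_one_apply_eq_norm [Nontrivial B] {a : B} (ha : 0 ≤ a) :
    ∃ f : StrongDual ℂ B, ‖f‖ ≤ 1 ∧ f 1 = 1 ∧ f a = ‖a‖ := by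
  -- Norming `1 + a` instead of `a` controls both values: a total of at least `1 + ‖a‖` forces `f 1`
  -- and `f a` to be maximal.
  obtain ⟨f, hf, hfa⟩ := exists_dual_vector'' ℂ (1 + a)
  have h1 : ‖f 1‖ ≤ 1 := by simpa using f.le_of_opNorm_le hf 1
  have h2 : ‖f a‖ ≤ ‖a‖ := by simpa using f.le_of_opNorm_le hf a
  have h3 : (f 1).re + (f a).re = ‖1 + a‖ := by
    have := congrArg Complex.re hfa
    simpa using this
  have h4 := one_add_norm_le_norm_one_add ha
  have h5 := Complex.re_le_norm (f 1)
  have h6 := Complex.re_le_norm (f a)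
  refine ⟨f, hf, ?_, ?_⟩
  · have h7 : (f 1).re = ‖f 1‖ := by linarith
    have h8 : ‖f 1‖ = 1 := by linarith
    have h9 := Complex.re_eq_norm.1 h7
    have := Complex.eq_re_of_ofReal_le (r := 0) (by simpa using h9)
    rw [this, h7, h8]; simp
  · have h7 : (f a).re = ‖f a‖ := by linarith
    have h8 : ‖f a‖ = ‖a‖ := by linarith
    have h9 := Complex.re_eq_norm.1 h7
    have := Complex.eq_re_of_ofReal_le (r := 0) (by simpa using h9)
    rw [this, h7, h8]

/-- The resolvent `(ε + r)⁻¹` of a positive element. -/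
theorem exists_resolvent {r : B} (hr : 0 ≤ r) {ε : ℝ} (hε : 0 < ε) :
    ∃ g : B, 0 ≤ g ∧ g ≤ algebraMap ℝ B ε⁻¹ ∧ g * r = 1 - ε • g := by
  have hs : ∀ t ∈ spectrum ℝ r, 0 ≤ t := fun t ht => spectrum_nonneg_of_nonneg hr ht
  have hne : ∀ t ∈ spectrum ℝ r, ε + t ≠ 0 := fun t ht => by have := hs t ht; positivity
  have hc : ContinuousOn (fun t : ℝ => (ε + t)⁻¹) (spectrum ℝ r) :=
    ContinuousOn.inv₀ (by fun_prop) hne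
  refine ⟨cfc (fun t : ℝ => (ε + t)⁻¹) r, ?_, ?_, ?_⟩
  · exact cfc_nonneg fun t ht => by have := hs t ht; positivity
  · refine cfc_le_algebraMap _ _ _ (fun t ht => ?_) (hf := hc)
    have := hs t ht
    exact inv_anti₀ hε (by linarith)
  · have hmul := cfc_mul (fun t : ℝ => (ε + t)⁻¹) (fun t : ℝ => t) r hc continuousOn_id
    rw [cfc_id' ℝ r] at hmul
    have hsub := cfc_sub (fun _ : ℝ => (1 : ℝ)) (fun t : ℝ => ε • (ε + t)⁻¹) r continuousOn_const
      (hc.const_smul ε)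
    rw [cfc_const_one ℝ r, cfc_smul ε _ r hc] at hsub
    rw [← hmul, ← hsub]
    refine cfc_congr fun t ht => ?_
    have := hne t ht
    simp only [smul_eq_mul]
    field_simp
    ring

end Unital

/-! ### Regularized projections in `B × B`. -/

section SqAbs

/-- The `A`-valued inner product `⟨x, x⟩` in the right module `A ⊕ A`. -/
def sqAbs {A : Type*} [NonUnitalSemiring A] [StarRing A] (x : A × A) : A :=
  star x.1 * x.1 + star x.2 * x.2

theorem sqAbs_nonneg {A : Type*} [NonUnitalRing A] [StarRing A] [PartialOrder A]
    [StarOrderedRing A] (x : A × A) : 0 ≤ sqAbs x :=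
  add_nonneg (star_mul_self_nonneg _) (star_mul_self_nonneg _)

variable {B : Type*} [CStarAlgebra B]

/-- With `g = (ε + |d|²)⁻¹`, the map `u ↦ u - d g ⟨d, u⟩` approximates the projection onto the
complement of `d B`; this is its exact Pythagorean defect. -/
theorem sqAbs_sub_mul_resolvent {d u : B × B} {g : B} {ε : ℝ} (hg : IsSelfAdjoint g)
    (hgr : g * sqAbs d = 1 - ε • g) :
    sqAbs (u.1 - d.1 * (g * (star d.1 * u.1 + star d.2 * u.2)),
        u.2 - d.2 * (g * (star d.1 * u.1 + star d.2 * u.2))) =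
      sqAbs u - (star (star d.1 * u.1 + star d.2 * u.2) * g * (star d.1 * u.1 + star d.2 * u.2) +
        ε • (star (g * (star d.1 * u.1 + star d.2 * u.2)) *
          (g * (star d.1 * u.1 + star d.2 * u.2)))) := by
  set z := star d.1 * u.1 + star d.2 * u.2 with hz
  have e1 : ∀ c : B, sqAbs (u.1 - d.1 * c, u.2 - d.2 * c) =
      sqAbs u - star z * c - star c * z + star c * (sqAbs d * c) := by
    intro c
    simp only [sqAbs, hz, star_sub, star_mul, star_add, star_star]
    noncomm_ring
  have e2 : star (g * z) * (sqAbs d * (g * z)) =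
      star z * g * z - ε • (star (g * z) * (g * z)) := by
    rw [star_mul, hg.star_eq]
    have : star z * g * (sqAbs d * (g * z)) = star z * (g * sqAbs d) * (g * z) := by
      simp only [mul_assoc]
    rw [this, hgr, mul_sub, mul_one, sub_mul, mul_smul_comm, smul_mul_assoc]
    simp only [mul_assoc]
  rw [e1, e2]
  rw [show star (g * z) * z = star z * g * z by rw [star_mul, hg.star_eq],
    show star z * (g * z) = star z * g * z by rw [mul_assoc]]
  abel

variable [PartialOrder B] [StarOrderedRing B]

theorem sqAbs_sub_mul_resolvent_le {d u : B × B} {g : B} {ε : ℝ} (hε : 0 ≤ ε) (hg : 0 ≤ g)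
    (hgr : g * sqAbs d = 1 - ε • g) :
    sqAbs (u.1 - d.1 * (g * (star d.1 * u.1 + star d.2 * u.2)),
        u.2 - d.2 * (g * (star d.1 * u.1 + star d.2 * u.2))) ≤ sqAbs u := by
  rw [sqAbs_sub_mul_resolvent (.of_nonneg hg) hgr]
  exact sub_le_self _ (add_nonneg (star_left_conjugate_nonneg hg _)
    (smul_nonneg hε (star_mul_self_nonneg _)))

/-- The difference of the two sides is `t |p - t⁻¹ q|²`. -/
theorem star_mul_self_add_le (p q : B) {t : ℝ} (ht : 0 < t) :
    star (p + q) * (p + q) ≤ (1 + t) • (star p * p) + (1 + t⁻¹) • (star q * q) := by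
  have h : 0 ≤ t • (star (p - t⁻¹ • q) * (p - t⁻¹ • q)) :=
    smul_nonneg ht.le (star_mul_self_nonneg _)
  have e : (1 + t) • (star p * p) + (1 + t⁻¹) • (star q * q) - star (p + q) * (p + q) =
      t • (star (p - t⁻¹ • q) * (p - t⁻¹ • q)) := by
    simp only [star_sub, star_add, star_smul, star_trivial, sub_mul, mul_sub, add_mul, mul_add,
      smul_mul_assoc, mul_smul_comm, smul_sub, smul_smul, add_smul, one_smul]
    rw [mul_inv_cancel₀ ht.ne', show t * (t⁻¹ * t⁻¹) = t⁻¹ by field_simp]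
    simp only [one_smul]
    abel
  rw [← sub_nonneg, e]
  exact h

theorem sqAbs_add_le (p q : B × B) {t : ℝ} (ht : 0 < t) :
    sqAbs (p + q) ≤ (1 + t) • sqAbs p + (1 + t⁻¹) • sqAbs q := by
  have h1 := star_mul_self_add_le p.1 q.1 ht
  have h2 := star_mul_self_add_le p.2 q.2 ht
  refine (add_le_add h1 h2).trans_eq ?_
  simp only [sqAbs, smul_add]
  abel

/-- For `d = u - v` the regularized projection nearly kills `d`, so the images of `u` and `v` differ
only by `ε d g`, whose square is at most `ε`. The image of `v` is bounded by contractivity. -/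
theorem sqAbs_sub_mul_resolvent_le_add {u v : B × B} {g : B} {ε t : ℝ} (hε : 0 < ε) (ht : 0 < t)
    (hg : 0 ≤ g) (hg' : g ≤ algebraMap ℝ B ε⁻¹) (hgr : g * sqAbs (u - v) = 1 - ε • g) :
    sqAbs (u.1 - (u - v).1 * (g * (star (u - v).1 * u.1 + star (u - v).2 * u.2)),
        u.2 - (u - v).2 * (g * (star (u - v).1 * u.1 + star (u - v).2 * u.2))) ≤
      sqAbs v + algebraMap ℝ B (t * ‖sqAbs v‖ + (1 + t⁻¹) * ε) := by
  set d := u - v with hd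
  set z := star d.1 * v.1 + star d.2 * v.2 with hz
  have hp : sqAbs (v.1 - d.1 * (g * z), v.2 - d.2 * (g * z)) ≤ sqAbs v :=
    sqAbs_sub_mul_resolvent_le hε.le hg hgr
  set p : B × B := (v.1 - d.1 * (g * z), v.2 - d.2 * (g * z)) with hpdef
  have hzz : star d.1 * u.1 + star d.2 * u.2 = z + sqAbs d := by
    have h1 : u.1 = v.1 + d.1 := by simp [hd]
    have h2 : u.2 = v.2 + d.2 := by simp [hd]
    rw [hz, h1, h2, sqAbs]
    noncomm_ring
  have hw : (u.1 - d.1 * (g * (star d.1 * u.1 + star d.2 * u.2)),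
      u.2 - d.2 * (g * (star d.1 * u.1 + star d.2 * u.2))) =
      p + (d.1 * (ε • g), d.2 * (ε • g)) := by
    rw [hzz, mul_add, hgr]
    have h1 : u.1 = v.1 + d.1 := by simp [hd]
    have h2 : u.2 = v.2 + d.2 := by simp [hd]
    refine Prod.ext ?_ ?_
    · simp only [hpdef, Prod.fst_add, h1]
      noncomm_ring
    · simp only [hpdef, Prod.snd_add, h2]
      noncomm_ring
  have hgs : star g = g := (IsSelfAdjoint.of_nonneg hg).star_eq
  have hq : sqAbs (d.1 * (ε • g), d.2 * (ε • g)) ≤ algebraMap ℝ B ε := by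
    have e : sqAbs (d.1 * (ε • g), d.2 * (ε • g)) = (ε ^ 2) • g - (ε ^ 3) • (star g * g) := by
      have e1 : sqAbs (d.1 * (ε • g), d.2 * (ε • g)) = (ε * ε) • ((g * sqAbs d) * g) := by
        simp only [sqAbs, star_mul, star_smul, star_trivial, hgs, smul_mul_assoc, mul_smul_comm,
          smul_smul, mul_add, add_mul, smul_add, mul_assoc]
      rw [e1, hgr, sub_mul, one_mul, smul_mul_assoc, smul_sub, smul_smul, hgs]
      congr 2 <;> ring
    rw [e]
    refine (sub_le_self _ (smul_nonneg (by positivity) (star_mul_self_nonneg _))).trans ?_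
    refine (smul_le_smul_of_nonneg_left hg' (by positivity : 0 ≤ ε ^ 2)).trans_eq ?_
    rw [Algebra.algebraMap_eq_smul_one, Algebra.algebraMap_eq_smul_one, smul_smul]
    congr 1
    field_simp
  rw [hw]
  refine (sqAbs_add_le _ _ ht).trans ?_
  have hnorm : sqAbs v ≤ algebraMap ℝ B ‖sqAbs v‖ :=
    (CStarAlgebra.norm_le_iff_le_algebraMap _ (norm_nonneg _) (sqAbs_nonneg v)).1 le_rfl
  calc (1 + t) • sqAbs p + (1 + t⁻¹) • sqAbs (d.1 * (ε • g), d.2 * (ε • g))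
      ≤ (1 + t) • sqAbs v + (1 + t⁻¹) • algebraMap ℝ B ε := by
        gcongr
    _ = sqAbs v + (t • sqAbs v + (1 + t⁻¹) • algebraMap ℝ B ε) := by
        rw [add_smul, one_smul, add_assoc]
    _ ≤ sqAbs v + (t • algebraMap ℝ B ‖sqAbs v‖ + (1 + t⁻¹) • algebraMap ℝ B ε) := by
        gcongr
    _ = _ := by
        simp only [Algebra.algebraMap_eq_smul_one, smul_smul, add_smul]

end SqAbs

/-! ### Quasi-states and simultaneous improvement. -/

section QuasiState

variable {A : Type*} [NonUnitalCStarAlgebra A] [PartialOrder A] [StarOrderedRing A]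

/-- Quasi-states: positive functionals of norm at most one. -/
structure IsQuasiState (φ : StrongDual ℂ A) : Prop where
  norm_le : ‖φ‖ ≤ 1
  nonneg : ∀ a, 0 ≤ a → 0 ≤ φ a

theorem IsQuasiState.re_mono {φ : StrongDual ℂ A} (hφ : IsQuasiState φ) {a b : A} (h : a ≤ b) :
    (φ a).re ≤ (φ b).re := by
  have := (Complex.nonneg_iff.1 (hφ.nonneg _ (sub_nonneg.2 h))).1
  simpa using this

omit [StarOrderedRing A] in
theorem IsQuasiState.re_le_norm {φ : StrongDual ℂ A} (hφ : IsQuasiState φ) (a : A) :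
    (φ a).re ≤ ‖a‖ :=
  (Complex.re_le_norm _).trans (by simpa using φ.le_of_opNorm_le hφ.norm_le a)

/-- The scalar `δ` lives only in the unitization, where `φ` is undefined. The positive part of `a`
stays in `A`, dominates `a`, and has norm at most `δ`. -/
theorem IsQuasiState.re_le_of_inr_le {φ : StrongDual ℂ A} (hφ : IsQuasiState φ) {a : A}
    (ha : IsSelfAdjoint a) {δ : ℝ} (hδ : 0 ≤ δ)
    (h : (a : Unitization ℂ A) ≤ algebraMap ℝ (Unitization ℂ A) δ) : (φ a).re ≤ δ := by
  refine (hφ.re_mono (CFC.le_posPart ha)).trans ((hφ.re_le_norm _).trans ?_)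
  rw [CFC.posPart_def]
  refine norm_cfcₙ_le fun x hx => ?_
  rw [Unitization.quasispectrum_eq_spectrum_inr' ℝ ℂ] at hx
  have := (le_algebraMap_iff_spectrum_le (ha.inr ℂ)).1 h x hx
  rw [Real.norm_of_nonneg (posPart_nonneg x)]
  exact sup_le this hδ

/-- Restrict a norming state of the unitization; the restriction may lose norm, hence only a
quasi-state is claimed. -/
theorem exists_quasiState_apply_eq_norm {a : A} (ha : 0 ≤ a) :
    ∃ φ : StrongDual ℂ A, IsQuasiState φ ∧ φ a = ‖a‖ := by
  obtain ⟨f, hf, hf1, hfa⟩ :=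
    exists_map_one_apply_eq_norm (Unitization.inr_nonneg_iff.2 ha : (0 : Unitization ℂ A) ≤ a)
  let i : A →L[ℂ] Unitization ℂ A :=
    (Unitization.inrNonUnitalStarAlgHom ℂ A : A →ₗ[ℂ] Unitization ℂ A).mkContinuous 1
      fun x => by simp [Unitization.norm_inr]
  have hi : ‖i‖ ≤ 1 := LinearMap.mkContinuous_norm_le _ zero_le_one _
  refine ⟨f.comp i, ⟨?_, fun b hb => ?_⟩, ?_⟩
  · exact (f.opNorm_comp_le i).trans (mul_le_one₀ hf (norm_nonneg _) hi)
  · exact nonneg_of_map_one hf hf1 (Unitization.inr_nonneg_iff.2 hb)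
  · rw [Unitization.norm_inr] at hfa
    exact hfa

/-- Two elements `u`, `v` of the Hilbert module `A ⊕ A` can be approximately improved
simultaneously by moving along the submodule generated by `u - v`. -/
theorem exists_sqAbs_le_of_quasiState (u v : A × A) {δ : ℝ} (hδ : 0 < δ) :
    ∃ c : A, ∀ φ : StrongDual ℂ A, IsQuasiState φ →
      (φ (sqAbs (u - ((u - v).1 * c, (u - v).2 * c)))).re ≤ (φ (sqAbs u)).re ∧
      (φ (sqAbs (u - ((u - v).1 * c, (u - v).2 * c)))).re ≤ (φ (sqAbs v)).re + δ := by
  let j : A × A → Unitization ℂ A × Unitization ℂ A := fun x => (x.1, x.2)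
  have hj : ∀ x, sqAbs (j x) = (sqAbs x : A) := fun x => by simp [sqAbs, j]
  have hjsub : ∀ x y, j (x - y) = j x - j y := fun x y => by simp [j]
  -- The parameters `t` and `ε` make each of the two error terms at most `δ / 2`.
  set t : ℝ := δ / (2 * (‖sqAbs (j v)‖ + 1)) with ht
  have ht0 : 0 < t := by positivity
  set ε : ℝ := δ / (2 * (1 + t⁻¹)) with hε
  have hε0 : 0 < ε := by positivity
  obtain ⟨g, hg, hg', hgr⟩ := exists_resolvent (sqAbs_nonneg (j u - j v)) hε0
  have hbound : t * ‖sqAbs (j v)‖ + (1 + t⁻¹) * ε ≤ δ := by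
    have h1 : (1 + t⁻¹) * ε = δ / 2 := by rw [hε]; field_simp
    have h2 : t * ‖sqAbs (j v)‖ ≤ t * (‖sqAbs (j v)‖ + 1) := by gcongr; linarith
    have h3 : t * (‖sqAbs (j v)‖ + 1) = δ / 2 := by rw [ht]; field_simp
    linarith
  set z : A := star (u - v).1 * u.1 + star (u - v).2 * u.2 with hz
  -- `A` is an ideal in its unitization, so the coefficient `g z` already lies in `A`.
  let c : A := (g * (z : Unitization ℂ A)).snd
  have hc : (c : Unitization ℂ A) = g * (z : Unitization ℂ A) := by
    ext <;> simp [c]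
  have hjw : j (u - ((u - v).1 * c, (u - v).2 * c)) =
      ((j u).1 - (j u - j v).1 * (g * (star (j u - j v).1 * (j u).1 + star (j u - j v).2 * (j u).2)),
      (j u).2 - (j u - j v).2 * (g * (star (j u - j v).1 * (j u).1 + star (j u - j v).2 * (j u).2)))
      := by
    have : (z : Unitization ℂ A) =
        star (j u - j v).1 * (j u).1 + star (j u - j v).2 * (j u).2 := by
      simp [hz, j]
    rw [← this, ← hc]
    simp [j]
  have hle1 := sqAbs_sub_mul_resolvent_le (u := j u) hε0.le hg hgr
  have hle2 := sqAbs_sub_mul_resolvent_le_add hε0 ht0 hg hg' hgr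
  rw [← hjw, hj, hj] at hle1 hle2
  have hsa : ∀ x : A × A, IsSelfAdjoint (sqAbs x) := fun x => .of_nonneg (sqAbs_nonneg x)
  refine ⟨c, fun φ hφ => ⟨hφ.re_mono ?_, ?_⟩⟩
  · exact (Unitization.inr_le_iff _ _ (hsa _) (hsa _)).1 hle1
  · have := hφ.re_le_of_inr_le ((hsa (u - ((u - v).1 * c, (u - v).2 * c))).sub (hsa v)) hδ.le (by
      rw [Unitization.inr_sub, sub_le_iff_le_add']
      refine hle2.trans ?_
      gcongr
      rw [← hj]
      exact hbound)
    rw [map_sub, Complex.sub_re] at this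
    linarith

end QuasiState

/-! ### Pure states separate points from closed right submodules. -/

section Separation

variable {A : Type*} [NonUnitalCStarAlgebra A]

/-- Right submodules of the Hilbert module `A ⊕ A`. -/
def IsRightInvariant (S : Submodule ℂ (A × A)) : Prop :=
  ∀ x ∈ S, ∀ a : A, (x.1 * a, x.2 * a) ∈ S

variable [PartialOrder A] [StarOrderedRing A]

variable (A) in
/-- The set of quasi-states, with the weak-* topology on the ambient space. -/
def quasiStateSpace : Set (WeakDual ℂ A) := {φ | IsQuasiState (WeakDual.toStrongDual φ)}

-- Banach–Alaoglu. Quasi-states are used because the states of a non-unital algebra need not be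
-- weak-* closed.
omit [StarOrderedRing A] in
theorem isCompact_quasiStateSpace : IsCompact (quasiStateSpace A) := by
  have h1 := WeakDual.isCompact_closedBall (𝕜 := ℂ) (E := A) 0 1
  have h2 : IsClosed {φ : WeakDual ℂ A | ∀ a : A, 0 ≤ a → 0 ≤ φ a} := by
    simp only [Set.ofPred_forall]
    refine isClosed_iInter fun a => isClosed_iInter fun _ => ?_
    exact isClosed_le continuous_const (WeakDual.eval_continuous a)
  refine (h1.inter_right h2).of_isClosed_subset ?_ ?_
  · convert (h1.inter_right h2).isClosed using 1
    ext φ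
    simp only [Set.mem_inter_iff, Set.mem_preimage, mem_closedBall_zero_iff]
    exact ⟨fun h => ⟨h.1, h.2⟩, fun h => ⟨h.1, h.2⟩⟩
  · intro φ h
    exact ⟨by simpa using h.1, h.2⟩

variable {S : Submodule ℂ (A × A)} {y : A × A}

/-- Directedness: two approximations of `y` in a right submodule can be combined. -/
theorem exists_mem_sqAbs_sub_le (hS : IsRightInvariant S) {s₁ s₂ : A × A} (h₁ : s₁ ∈ S)
    (h₂ : s₂ ∈ S) {δ : ℝ} (hδ : 0 < δ) :
    ∃ s ∈ S, ∀ φ ∈ quasiStateSpace A, (φ (sqAbs (y - s))).re ≤ (φ (sqAbs (y - s₁))).re ∧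
      (φ (sqAbs (y - s))).re ≤ (φ (sqAbs (y - s₂))).re + δ := by
  obtain ⟨c, hc⟩ := exists_sqAbs_le_of_quasiState (y - s₁) (y - s₂) hδ
  have hd : (y - s₁) - (y - s₂) = s₂ - s₁ := by abel
  rw [hd] at hc
  refine ⟨s₁ + ((s₂ - s₁).1 * c, (s₂ - s₁).2 * c),
    S.add_mem h₁ (hS _ (S.sub_mem h₂ h₁) c), fun φ hφ => ?_⟩
  rw [← sub_sub]
  exact hc _ hφ

theorem re_apply_sqAbs_nonneg {φ : WeakDual ℂ A} (hφ : φ ∈ quasiStateSpace A) (x : A × A) :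
    0 ≤ (φ (sqAbs x)).re :=
  (Complex.nonneg_iff.1 (hφ.2 _ (sqAbs_nonneg x))).1

theorem norm_sq_le_of_quasiState {x : A × A} {r : ℝ}
    (h : ∀ φ ∈ quasiStateSpace A, (φ (sqAbs x)).re ≤ r) : ‖x‖ ^ 2 ≤ r := by
  obtain ⟨φ, hφ, hφx⟩ := exists_quasiState_apply_eq_norm (sqAbs_nonneg x)
  have h1 : ‖sqAbs x‖ ≤ r := by
    have := h (StrongDual.toWeakDual φ) hφ
    have h2 : (StrongDual.toWeakDual φ) (sqAbs x) = φ (sqAbs x) := rfl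
    rw [h2, hφx] at this
    simpa using this
  have h2 : ‖x.1‖ ^ 2 ≤ ‖sqAbs x‖ := by
    rw [sq, ← CStarRing.norm_star_mul_self]
    exact CStarAlgebra.norm_le_norm_of_nonneg_of_le (star_mul_self_nonneg _)
      (le_add_of_nonneg_right (star_mul_self_nonneg _))
  have h3 : ‖x.2‖ ^ 2 ≤ ‖sqAbs x‖ := by
    rw [sq, ← CStarRing.norm_star_mul_self]
    exact CStarAlgebra.norm_le_norm_of_nonneg_of_le (star_mul_self_nonneg _)
      (le_add_of_nonneg_left (star_mul_self_nonneg _))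
  rw [Prod.norm_def]
  rcases max_choice ‖x.1‖ ‖x.2‖ with h | h <;> rw [h] <;> linarith

/-- The squared distance of `y` from `S` in the localization at `φ`. -/
def sqDist (S : Submodule ℂ (A × A)) (y : A × A) (φ : WeakDual ℂ A) : ℝ :=
  ⨅ s : S, (φ (sqAbs (y - s))).re

theorem sqDist_le {φ : WeakDual ℂ A} (hφ : φ ∈ quasiStateSpace A) {s : A × A} (hs : s ∈ S) :
    sqDist S y φ ≤ (φ (sqAbs (y - s))).re :=
  ciInf_le (f := fun s : S => (φ (sqAbs (y - s))).re)
    ⟨0, by rintro _ ⟨s, rfl⟩; exact re_apply_sqAbs_nonneg hφ _⟩ ⟨s, hs⟩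

omit [PartialOrder A] [StarOrderedRing A] in
theorem exists_lt_sqDist_add (φ : WeakDual ℂ A) {δ : ℝ} (hδ : 0 < δ) :
    ∃ s ∈ S, (φ (sqAbs (y - s))).re < sqDist S y φ + δ := by
  obtain ⟨s, hs⟩ := exists_lt_of_ciInf_lt (f := fun s : S => (φ (sqAbs (y - s))).re)
    (lt_add_of_pos_right (sqDist S y φ) hδ)
  exact ⟨s, s.2, hs⟩

omit [PartialOrder A] [StarOrderedRing A] in
theorem continuous_re_eval (a : A) : Continuous fun φ : WeakDual ℂ A => (φ a).re :=
  Complex.continuous_re.comp (WeakDual.eval_continuous a)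

theorem upperSemicontinuousOn_sqDist :
    UpperSemicontinuousOn (sqDist S y) (quasiStateSpace A) := by
  intro φ hφ r hr
  obtain ⟨s, hs⟩ := exists_lt_of_ciInf_lt hr
  have : {ψ : WeakDual ℂ A | (ψ (sqAbs (y - s))).re < r} ∈ nhds φ :=
    (isOpen_lt (continuous_re_eval _) continuous_const).mem_nhds hs
  filter_upwards [mem_nhdsWithin_of_mem_nhds this, self_mem_nhdsWithin] with ψ h1 h2
  exact (sqDist_le h2 s.2).trans_lt h1

/-- Each quasi-state has an approximant that works on a neighbourhood. Compactness leaves finitely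
many, and directedness merges them into a uniformly good one, hence one close in norm. -/
theorem mem_closure_of_sqDist_le_zero (hS : IsRightInvariant S)
    (h : ∀ φ ∈ quasiStateSpace A, sqDist S y φ ≤ 0) : y ∈ closure (S : Set (A × A)) := by
  rw [Metric.mem_closure_iff]
  intro ε hε
  have key : ∃ s ∈ S, ∀ φ ∈ quasiStateSpace A, φ ∈ quasiStateSpace A →
      (φ (sqAbs (y - s))).re ≤ ε ^ 2 / 4 + ε ^ 2 / 4 := by
    -- Every merge costs some error, so the induction carries an arbitrary slack `δ`.
    have hind : ∀ δ > 0, ∃ s ∈ S, ∀ φ ∈ quasiStateSpace A, φ ∈ quasiStateSpace A →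
      (φ (sqAbs (y - s))).re ≤ ε ^ 2 / 4 + δ := by
      refine isCompact_quasiStateSpace.induction_on
        (p := fun K => ∀ δ > 0, ∃ s ∈ S, ∀ φ ∈ K, φ ∈ quasiStateSpace A →
          (φ (sqAbs (y - s))).re ≤ ε ^ 2 / 4 + δ) ?_ ?_ ?_ ?_
      · exact fun δ _ => ⟨0, S.zero_mem, by simp⟩
      · intro K L hKL hL δ hδ
        obtain ⟨s, hs, h1⟩ := hL δ hδ
        exact ⟨s, hs, fun φ hφ => h1 φ (hKL hφ)⟩
      · intro K L hK hL δ hδ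
        obtain ⟨s₁, hs₁, h1⟩ := hK (δ / 2) (half_pos hδ)
        obtain ⟨s₂, hs₂, h2⟩ := hL (δ / 2) (half_pos hδ)
        obtain ⟨s, hs, h3⟩ := exists_mem_sqAbs_sub_le (y := y) hS hs₁ hs₂ (half_pos hδ)
        refine ⟨s, hs, fun φ hφ hφ' => ?_⟩
        rcases hφ with hφ | hφ
        · have := h1 φ hφ hφ'
          linarith [(h3 φ hφ').1]
        · have := h2 φ hφ hφ'
          linarith [(h3 φ hφ').2]
      · intro φ hφ
        obtain ⟨s, hs, h1⟩ := exists_lt_sqDist_add (S := S) (y := y) φ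
          (by positivity : 0 < ε ^ 2 / 4)
        refine ⟨{ψ : WeakDual ℂ A | (ψ (sqAbs (y - s))).re < ε ^ 2 / 4},
          mem_nhdsWithin_of_mem_nhds
            ((isOpen_lt (continuous_re_eval _) continuous_const).mem_nhds ?_), ?_⟩
        · exact h1.trans_le (by linarith [h φ hφ])
        · exact fun δ hδ => ⟨s, hs, fun ψ hψ _ => by
            have : (ψ (sqAbs (y - s))).re < ε ^ 2 / 4 := hψ
            linarith⟩
    exact hind _ (by positivity)
  obtain ⟨s, hs, h1⟩ := key
  refine ⟨s, hs, ?_⟩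
  rw [dist_eq_norm]
  have := norm_sq_le_of_quasiState fun φ hφ => h1 φ hφ hφ
  refine lt_of_pow_lt_pow_left₀ 2 hε.le ?_
  nlinarith [sq_pos_of_pos hε]

/-- An infimum of affine functions is concave in general; convexity comes from directedness, since
one `s` is nearly optimal for both `φ₁` and `φ₂`. -/
theorem sqDist_convex_combination_le (hS : IsRightInvariant S) {φ φ₁ φ₂ : WeakDual ℂ A}
    (h₁ : φ₁ ∈ quasiStateSpace A) (h₂ : φ₂ ∈ quasiStateSpace A) (hφ : φ ∈ quasiStateSpace A)
    {a b : ℝ} (ha : 0 ≤ a) (hb : 0 ≤ b) (hab : a + b = 1) (h : a • φ₁ + b • φ₂ = φ) :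
    sqDist S y φ ≤ a * sqDist S y φ₁ + b * sqDist S y φ₂ := by
  refine le_of_forall_pos_le_add fun δ hδ => ?_
  obtain ⟨s₁, hs₁, e₁⟩ := exists_lt_sqDist_add (S := S) (y := y) φ₁ (half_pos hδ)
  obtain ⟨s₂, hs₂, e₂⟩ := exists_lt_sqDist_add (S := S) (y := y) φ₂ (half_pos hδ)
  obtain ⟨s, hs, hle⟩ := exists_mem_sqAbs_sub_le (y := y) hS hs₁ hs₂ (half_pos hδ)
  refine (sqDist_le hφ hs).trans ?_
  have e : (φ (sqAbs (y - s))).re =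
      a * (φ₁ (sqAbs (y - s))).re + b * (φ₂ (sqAbs (y - s))).re := by
    rw [← h]
    change (a • φ₁ (sqAbs (y - s)) + b • φ₂ (sqAbs (y - s))).re = _
    simp
  rw [e]
  have i₁ : (φ₁ (sqAbs (y - s))).re ≤ sqDist S y φ₁ + δ := by linarith [(hle φ₁ h₁).1]
  have i₂ : (φ₂ (sqAbs (y - s))).re ≤ sqDist S y φ₂ + δ := by linarith [(hle φ₂ h₂).2]
  calc _ ≤ a * (sqDist S y φ₁ + δ) + b * (sqDist S y φ₂ + δ) := by gcongr
    _ = a * sqDist S y φ₁ + b * sqDist S y φ₂ + (a + b) * δ := by ring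
    _ = _ := by rw [hab, one_mul]

omit [StarOrderedRing A] in
theorem zero_mem_quasiStateSpace : (0 : WeakDual ℂ A) ∈ quasiStateSpace A :=
  ⟨by simp, fun _ _ => le_rfl⟩

omit [PartialOrder A] [StarOrderedRing A] in
theorem locallyConvexSpace_weakDual : LocallyConvexSpace ℝ (WeakDual ℂ A) :=
  inferInstanceAs (LocallyConvexSpace ℝ (WeakBilin (topDualPairing ℂ A)))

/-- A point outside the closure of a right submodule has positive distance from it at some extreme
quasi-state. -/
theorem exists_extremePoint_sqDist_pos (hS : IsRightInvariant S)
    (hy : y ∉ closure (S : Set (A × A))) :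
    ∃ φ ∈ (quasiStateSpace A).extremePoints ℝ, 0 < sqDist S y φ := by
  obtain ⟨φ₀, hφ₀, hmax⟩ := (upperSemicontinuousOn_sqDist (S := S) (y := y)).exists_isMaxOn
    ⟨0, zero_mem_quasiStateSpace⟩ isCompact_quasiStateSpace
  have hpos : 0 < sqDist S y φ₀ := by
    by_contra h0
    exact hy (mem_closure_of_sqDist_le_zero hS fun φ hφ => (hmax hφ).trans (not_lt.1 h0))
  set M := sqDist S y φ₀ with hM
  set F : Set (WeakDual ℂ A) := {φ | φ ∈ quasiStateSpace A ∧ M ≤ sqDist S y φ} with hF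
  -- A superlevel set of an infimum of continuous functions is an intersection of closed sets.
  have hFeq : F = quasiStateSpace A ∩ ⋂ s : S, {φ | M ≤ (φ (sqAbs (y - s))).re} := by
    ext φ
    simp only [hF, Set.mem_ofPred_eq, Set.mem_inter_iff, Set.mem_iInter]
    refine and_congr_right fun hφ => ⟨fun h s => h.trans (sqDist_le hφ s.2), fun h => ?_⟩
    exact le_ciInf h
  have hFc : IsCompact F := by
    rw [hFeq]
    exact isCompact_quasiStateSpace.inter_right
      (isClosed_iInter fun s => isClosed_le continuous_const (continuous_re_eval _))
  -- The maximizers of a convex function form a face.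
  have hFext : IsExtreme ℝ (quasiStateSpace A) F := by
    refine ⟨fun φ h => h.1, ?_⟩
    rintro φ₁ h₁ φ₂ h₂ φ hφ ⟨a, b, ha, hb, hab, h⟩
    refine ⟨h₁, ?_⟩
    have e := sqDist_convex_combination_le (y := y) hS h₁ h₂ hφ.1 ha.le hb.le hab h
    have e₂ : sqDist S y φ₂ ≤ M := hmax h₂
    have e₃ := hφ.2
    have e₄ : a * M ≤ a * sqDist S y φ₁ := by
      have : b * sqDist S y φ₂ ≤ b * M := by gcongr
      have : a * M + b * M = M := by rw [← add_mul, hab, one_mul]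
      linarith
    exact le_of_mul_le_mul_left e₄ ha
  have := locallyConvexSpace_weakDual (A := A)
  obtain ⟨φ, hφ⟩ := hFc.extremePoints_nonempty ⟨φ₀, hφ₀, le_rfl⟩
  exact ⟨φ, hFext.extremePoints_subset_extremePoints hφ, hpos.trans_le hφ.1.2⟩

/-- Positive functionals of norm at most one, as bundled positive linear maps. -/
def IsQuasiState.toPositive {φ : StrongDual ℂ A} (hφ : IsQuasiState φ) : A →ₚ[ℂ] ℂ :=
  PositiveLinearMap.mk₀ φ.toLinearMap hφ.nonneg

-- If `0 < ‖φ‖ < 1`, then `φ` lies strictly between the quasi-states `0` and `φ / ‖φ‖`.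
omit [StarOrderedRing A] in
theorem norm_eq_one_of_mem_extremePoints {φ : WeakDual ℂ A}
    (hφ : φ ∈ (quasiStateSpace A).extremePoints ℝ) (h0 : φ ≠ 0) :
    ‖WeakDual.toStrongDual φ‖ = 1 := by
  set ψ := WeakDual.toStrongDual φ with hψ
  have hψ0 : ψ ≠ 0 := by simpa [hψ] using h0
  have hn : 0 < ‖ψ‖ := norm_pos_iff.2 hψ0
  have hq : IsQuasiState ψ := hφ.1
  by_contra hne
  have hlt : ‖ψ‖ < 1 := lt_of_le_of_ne hq.norm_le hne
  have hmem : (‖ψ‖⁻¹ • φ : WeakDual ℂ A) ∈ quasiStateSpace A := by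
    refine ⟨?_, fun a ha => ?_⟩
    · change ‖‖ψ‖⁻¹ • ψ‖ ≤ 1
      rw [norm_smul, norm_inv, norm_norm, inv_mul_cancel₀ hn.ne']
    · change 0 ≤ ‖ψ‖⁻¹ • ψ a
      exact smul_nonneg (by positivity) (hq.nonneg a ha)
  have hseg : φ ∈ openSegment ℝ (0 : WeakDual ℂ A) (‖ψ‖⁻¹ • φ) := by
    refine ⟨1 - ‖ψ‖, ‖ψ‖, sub_pos.2 hlt, hn, by ring, ?_⟩
    rw [smul_zero, zero_add]
    refine DFunLike.ext _ _ fun x => ?_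
    change ‖ψ‖ • (‖ψ‖⁻¹ • φ x) = φ x
    rw [smul_smul, mul_inv_cancel₀ hn.ne', one_smul]
  exact h0 (hφ.2 zero_mem_quasiStateSpace hmem hseg).symm

/-- Pure states separate points from closed right submodules of `A ⊕ A`. -/
theorem exists_pureState_le_sqAbs_sub (hS : IsRightInvariant S)
    (hy : y ∉ closure (S : Set (A × A))) :
    ∃ ω : A →ₚ[ℂ] ℂ, IsPureState ω ∧ ∃ m > 0, ∀ s ∈ S, m ≤ (ω (sqAbs (y - s))).re := by
  obtain ⟨φ, hφ, hpos⟩ := exists_extremePoint_sqDist_pos hS hy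
  have hq : IsQuasiState (WeakDual.toStrongDual φ) := hφ.1
  have hφ0 : φ ≠ 0 := by
    rintro rfl
    obtain ⟨s, hs⟩ : ∃ s, s ∈ S := ⟨0, S.zero_mem⟩
    have := hpos.trans_le (sqDist_le hφ.1 hs)
    exact this.ne rfl
  have hdual : toDual hq.toPositive = WeakDual.toStrongDual φ := rfl
  refine ⟨hq.toPositive, ⟨⟨hq.toPositive, ?_, rfl⟩, ?_⟩, sqDist S y φ, hpos, fun s hs =>
    sqDist_le hφ.1 hs⟩
  · rw [IsState, hdual]
    exact norm_eq_one_of_mem_extremePoints hφ hφ0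
  · rintro _ ⟨ω₁, h₁, rfl⟩ _ ⟨ω₂, h₂, rfl⟩ ⟨a, b, ha, hb, hab, h⟩
    have hmem : ∀ ω : A →ₚ[ℂ] ℂ, IsState ω →
        StrongDual.toWeakDual (toDual ω) ∈ quasiStateSpace A := fun ω hω =>
      ⟨le_of_eq hω, fun a ha => map_nonneg ω ha⟩
    have := hφ.2 (hmem ω₁ h₁) (hmem ω₂ h₂) ⟨a, b, ha, hb, hab, h⟩
    exact this

end Separation

/-! ### Density tested at pure states. -/

section StateLocalization

variable {A : Type*} [NonUnitalCStarAlgebra A] [PartialOrder A] [StarOrderedRing A]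
  (ω : A →ₚ[ℂ] ℂ)

theorem norm_sq_iota (x : A) : ‖iota ω x‖ ^ 2 = (ω (star x * x)).re := by
  rw [← @inner_self_eq_norm_sq ℂ, inner_iota]
  rfl

theorem re_apply_sqAbs (x : A × A) :
    (ω (sqAbs x)).re = ‖iota ω x.1‖ ^ 2 + ‖iota ω x.2‖ ^ 2 := by
  rw [norm_sq_iota, norm_sq_iota, sqAbs, map_add, Complex.add_re]

theorem continuous_iota : Continuous (iota ω) := by
  refine AddMonoidHomClass.continuous_of_bound (iota ω) (√‖toDual ω‖) fun x => ?_
  refine le_of_sq_le_sq ?_ (by positivity)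
  rw [norm_sq_iota, mul_pow, Real.sq_sqrt (norm_nonneg _), sq ‖x‖, ← CStarRing.norm_star_mul_self]
  exact (Complex.re_le_norm _).trans ((toDual ω).le_opNorm _)

theorem denseRange_iota : DenseRange (iota ω) :=
  (UniformSpace.Completion.denseRange_coe : DenseRange ((↑) : ω.PreGNS → ω.GNS))

theorem dense_map_iota {S : Submodule ℂ A} (hS : Dense (S : Set A)) :
    Dense (S.map (iota ω) : Set ω.GNS) :=
  (denseRange_iota ω).dense_image (continuous_iota ω) hS

variable {ω}

/-- If all localizations at pure states of a right submodule of `A ⊕ A` are dense, it is dense. -/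
theorem dense_of_forall_pureState {S : Submodule ℂ (A × A)} (hS : IsRightInvariant S)
    (h : ∀ ω : A →ₚ[ℂ] ℂ, IsPureState ω →
      Dense (S.map ((iota ω).prodMap (iota ω)) : Set (ω.GNS × ω.GNS))) :
    Dense (S : Set (A × A)) := by
  intro y
  by_contra hy
  obtain ⟨ω, hω, m, hm, hle⟩ := exists_pureState_le_sqAbs_sub hS hy
  obtain ⟨_, ⟨s, hs, rfl⟩, hd⟩ := (h ω hω).exists_dist_lt (iota ω y.1, iota ω y.2)
    (Real.sqrt_pos.2 (half_pos hm))
  have h1 : ‖(iota ω (y - s).1, iota ω (y - s).2)‖ < √(m / 2) := by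
    rw [dist_eq_norm] at hd
    simpa using hd
  rw [Prod.norm_def, max_lt_iff] at h1
  have h2 : ∀ r : ℝ, 0 ≤ r → r < √(m / 2) → r ^ 2 < m / 2 := fun r hr h =>
    (Real.lt_sqrt hr).1 h
  have h3 := hle s hs
  rw [re_apply_sqAbs] at h3
  linarith [h2 _ (norm_nonneg _) h1.1, h2 _ (norm_nonneg _) h1.2]

/-- Pure states separate proper closed right ideals from the algebra. -/
theorem exists_pureState_not_dense {L : Submodule ℂ A} (hL : IsRightSubmodule L)
    (hcl : IsClosed (L : Set A)) (hne : L ≠ ⊤) :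
    ∃ ω : A →ₚ[ℂ] ℂ, IsPureState ω ∧ ¬ Dense (iota ω '' (L : Set A)) := by
  by_contra! hcon
  refine hne (Submodule.eq_top_iff'.2 fun x => ?_)
  -- A right ideal `L` is treated through the right submodule `L × A`.
  have hdense : Dense ((L.prod ⊤ : Submodule ℂ (A × A)) : Set (A × A)) := by
    refine dense_of_forall_pureState (fun x hx a => ⟨hL _ hx.1 a, trivial⟩) fun ω hω => ?_
    refine ((hcon ω hω).prod (denseRange_iota ω)).mono ?_
    rintro ⟨_, _⟩ ⟨⟨l, hl, rfl⟩, ⟨a, rfl⟩⟩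
    exact ⟨(l, a), ⟨hl, trivial⟩, rfl⟩
  have hcl' : IsClosed ((L.prod ⊤ : Submodule ℂ (A × A)) : Set (A × A)) :=
    hcl.prod isClosed_univ
  have : (x, (0 : A)) ∈ ((L.prod ⊤ : Submodule ℂ (A × A)) : Set (A × A)) := by
    rw [← hcl'.closure_eq]
    exact hdense _
  exact this.1

end StateLocalization

/-! ### Localization in interior tensor products. -/

section RepLocalization

variable {A : Type*} [NonUnitalCStarAlgebra A]
  {H : Type*} [NormedAddCommGroup H] [InnerProductSpace ℂ H] [CompleteSpace H]
  (π : A →⋆ₙₐ[ℂ] (H →L[ℂ] H))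

theorem inner_itmul (a b : A) (h k : H) :
    ⟪itmul π a h, itmul π b k⟫_ℂ = ⟪h, π (ip a b) k⟫_ℂ := by
  rw [itmul, itmul, UniformSpace.Completion.inner_coe, inner_tmul]

/-- The map `a ↦ a ⊗ h` into the interior tensor product. -/
def itmulLeft (h : H) : A →L[ℂ] IntTensor π :=
  LinearMap.mkContinuous
    { toFun := fun a => itmul π a h
      map_add' := fun a b => by
        rw [itmul, itmul, itmul, ← UniformSpace.Completion.coe_add]
        exact congrArg _ (TensorProduct.add_tmul a b h)
      map_smul' := fun c a => by
        rw [itmul, itmul, RingHom.id_apply, ← UniformSpace.Completion.coe_smul]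
        exact congrArg _ (TensorProduct.smul_tmul' c a h).symm }
    ‖h‖ fun a => by
      have h1 : ‖itmul π a h‖ = ‖π a h‖ := by
        refine (pow_left_inj₀ (norm_nonneg _) (norm_nonneg _) two_ne_zero).1 ?_
        rw [← @inner_self_eq_norm_sq ℂ, ← @inner_self_eq_norm_sq ℂ]
        rw [itmul, UniformSpace.Completion.inner_coe]
        rfl
      change ‖itmul π a h‖ ≤ _
      rw [h1, mul_comm]
      exact ((π a).le_opNorm h).trans (by gcongr; exact NonUnitalStarAlgHom.norm_apply_le π a)

/-- The localization of a subspace of `A ⊕ A` with respect to a representation. -/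
def repGraph (G : Submodule ℂ (A × A)) : Submodule ℂ (IntTensor π × IntTensor π) :=
  ⨆ h : H, G.map ((itmulLeft π h).toLinearMap.prodMap (itmulLeft π h).toLinearMap)

variable {π}

theorem mem_repGraph {G : Submodule ℂ (A × A)} {p : A × A} (hp : p ∈ G) (h : H) :
    (itmul π p.1 h, itmul π p.2 h) ∈ repGraph π G :=
  (le_iSup (fun h : H => G.map ((itmulLeft π h).toLinearMap.prodMap (itmulLeft π h).toLinearMap)) h)
    ⟨p, hp, rfl⟩

theorem repGraph_le {G : Submodule ℂ (A × A)} {K : Submodule ℂ (IntTensor π × IntTensor π)}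
    (hK : ∀ p ∈ G, ∀ h : H, (itmul π p.1 h, itmul π p.2 h) ∈ K) : repGraph π G ≤ K := by
  refine iSup_le fun h => ?_
  rintro _ ⟨p, hp, rfl⟩
  exact hK p hp h

variable (π)

theorem preLocRep_eq (T : A →ₗ.[ℂ] A) : preLocRep π T = (repGraph π T.graph).toLinearPMap := by
  rw [preLocRep]
  congr 1
  refine le_antisymm (Submodule.span_le.2 ?_) (repGraph_le ?_)
  · rintro _ ⟨x, h, rfl⟩
    exact mem_repGraph (T.mem_graph x) h
  · intro p hp h
    obtain ⟨x, h1, h2⟩ := (T.mem_graph_iff).1 hp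
    refine Submodule.subset_span ⟨x, h, ?_⟩
    rw [h1, h2]

theorem repGraph_graphSum (G G' : Submodule ℂ (A × A)) :
    repGraph π (graphSum G G') = graphSum (repGraph π G) (repGraph π G') := by
  simp only [repGraph, map_graphSum]
  simp only [graphSum, Submodule.map_iSup, iSup_sup_eq]

theorem dense_iSup_range_itmulLeft :
    Dense ((⨆ h : H, LinearMap.range (itmulLeft π h).toLinearMap : Submodule ℂ (IntTensor π)) :
      Set (IntTensor π)) := by
  refine (UniformSpace.Completion.denseRange_coe (α := PreTensor π)).mono ?_
  rintro _ ⟨t, rfl⟩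
  let P : PreTensor π → Prop := fun t => (t : IntTensor π) ∈
    (⨆ h : H, LinearMap.range (itmulLeft π h).toLinearMap : Submodule ℂ (IntTensor π))
  have hadd : ∀ x y : PreTensor π, P x → P y → P (x + y) := fun x y hx hy => by
    have := Submodule.add_mem _ hx hy
    rwa [← UniformSpace.Completion.coe_add] at this
  refine TensorProduct.induction_on (motive := P) t ?_ ?_ hadd
  · exact Submodule.zero_mem _
  · intro a h
    exact (le_iSup (fun h : H => LinearMap.range (itmulLeft π h).toLinearMap) h) ⟨a, rfl⟩

theorem dense_map_fst_repGraph {G : Submodule ℂ (A × A)}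
    (hG : Dense (G.map (LinearMap.fst ℂ A A) : Set A)) :
    Dense ((repGraph π G).map (LinearMap.fst ℂ (IntTensor π) (IntTensor π)) :
      Set (IntTensor π)) := by
  refine Dense.of_closure ((dense_iSup_range_itmulLeft π).mono ?_)
  change (_ : Submodule ℂ (IntTensor π)) ≤ Submodule.topologicalClosure _
  refine iSup_le fun h => ?_
  rintro _ ⟨a, rfl⟩
  refine map_mem_closure (itmulLeft π h).continuous (hG a) ?_
  rintro _ ⟨p, hp, rfl⟩
  exact ⟨_, mem_repGraph hp h, rfl⟩

theorem dense_repGraph {S : Submodule ℂ (A × A)} (hS : Dense (S : Set (A × A))) :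
    Dense (repGraph π S : Set (IntTensor π × IntTensor π)) := by
  have hmem : ∀ (a b : A) (h : H),
      (itmul π a h, itmul π b h) ∈ (repGraph π S).topologicalClosure := by
    intro a b h
    exact map_mem_closure (f := Prod.map (itmulLeft π h) (itmulLeft π h))
      ((itmulLeft π h).continuous.prodMap (itmulLeft π h).continuous)
      (hS (a, b)) fun p hp => mem_repGraph hp h
  refine Dense.of_closure
    (((dense_iSup_range_itmulLeft π).prod (dense_iSup_range_itmulLeft π)).mono ?_)
  rintro ⟨s, t⟩ ⟨hs, ht⟩
  have h1 : ((⨆ h : H, LinearMap.range (itmulLeft π h).toLinearMap)).map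
      (LinearMap.inl ℂ (IntTensor π) (IntTensor π)) ≤ (repGraph π S).topologicalClosure := by
    rw [Submodule.map_iSup]
    refine iSup_le fun h => ?_
    rintro _ ⟨_, ⟨a, rfl⟩, rfl⟩
    have := hmem a 0 h
    rwa [show itmul π 0 h = 0 from (itmulLeft π h).map_zero] at this
  have h2 : ((⨆ h : H, LinearMap.range (itmulLeft π h).toLinearMap)).map
      (LinearMap.inr ℂ (IntTensor π) (IntTensor π)) ≤ (repGraph π S).topologicalClosure := by
    rw [Submodule.map_iSup]
    refine iSup_le fun h => ?_
    rintro _ ⟨_, ⟨a, rfl⟩, rfl⟩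
    have := hmem 0 a h
    rwa [show itmul π 0 h = 0 from (itmulLeft π h).map_zero] at this
  have h3 := Submodule.add_mem _ (h1 ⟨s, hs, rfl⟩) (h2 ⟨t, ht, rfl⟩)
  have h4 : (s, t) ∈ (repGraph π S).topologicalClosure := by simpa using h3
  exact h4

/-- The canonical map `a ⊗ h ↦ π a h` from the interior tensor product to the Hilbert space. -/
def intTensorEval : IntTensor π →L[ℂ] H :=
  ContinuousLinearMap.extend
    ((evalMap π).mkContinuous 1 fun t => by
      rw [one_mul]
      refine le_of_eq ((pow_left_inj₀ (norm_nonneg _) (norm_nonneg _) two_ne_zero).1 ?_)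
      rw [← @inner_self_eq_norm_sq ℂ, ← @inner_self_eq_norm_sq ℂ]
      rfl)
    (UniformSpace.Completion.toComplL (𝕜 := ℂ) (E := PreTensor π))

theorem intTensorEval_itmul (a : A) (h : H) : intTensorEval π (itmul π a h) = π a h :=
  ContinuousLinearMap.extend_eq _ UniformSpace.Completion.denseRange_coe
    (UniformSpace.Completion.isUniformInducing_coe _) (tmul π a h)

end RepLocalization

/-! ### Formally adjoint pairs of graphs over `A`. -/

section ModulePairs

variable {A : Type*} [NonUnitalCStarAlgebra A]

/-- `G` and `G'` are the graphs of formally adjoint densely defined operators in the Hilbert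
module `A`. -/
structure IsModuleAdjointPair (G G' : Submodule ℂ (A × A)) : Prop where
  ip_eq : ∀ p ∈ G, ∀ q ∈ G', ip p.2 q.1 = ip p.1 q.2
  dense_left : Dense (G.map (LinearMap.fst ℂ A A) : Set A)
  dense_right : Dense (G'.map (LinearMap.fst ℂ A A) : Set A)

theorem isRightInvariant_graphSum {G G' : Submodule ℂ (A × A)} (hG : IsRightInvariant G)
    (hG' : IsRightInvariant G') : IsRightInvariant (graphSum G G') := by
  intro x hx a
  obtain ⟨p, hp, q, hq, rfl⟩ := mem_graphSum.1 hx
  exact mem_graphSum.2 ⟨_, hG p hp a, _, hG' q hq a, by simp [add_mul]⟩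

/-- Pythagoras: formal adjointness cancels the cross terms. -/
theorem sqAbs_rotate_add {p q : A × A} (h : ip p.2 q.1 = ip p.1 q.2) :
    sqAbs (p.2 + q.1, -p.1 + q.2) = sqAbs p + sqAbs q := by
  have h' : star q.1 * p.2 = star q.2 * p.1 := by
    have := congrArg star h
    simpa [ip] using this
  simp only [ip] at h
  simp only [sqAbs, star_add, star_neg, add_mul, mul_add, neg_mul, mul_neg, h, h']
  abel

theorem IsModuleAdjointPair.repGraph {G G' : Submodule ℂ (A × A)} (h : IsModuleAdjointPair G G')
    {H : Type*} [NormedAddCommGroup H] [InnerProductSpace ℂ H] [CompleteSpace H]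
    (π : A →⋆ₙₐ[ℂ] (H →L[ℂ] H)) : IsFormalAdjointPair (repGraph π G) (repGraph π G') where
  inner_eq p hp q hq := by
    let K (q : IntTensor π × IntTensor π) : Submodule ℂ (IntTensor π × IntTensor π) :=
      LinearMap.ker ((innerSL ℂ q.1).toLinearMap ∘ₗ LinearMap.snd ℂ _ _ -
        (innerSL ℂ q.2).toLinearMap ∘ₗ LinearMap.fst ℂ _ _)
    have hK : ∀ p q, p ∈ K q ↔ ⟪q.1, p.2⟫_ℂ = ⟪q.2, p.1⟫_ℂ := fun p q => by
      simp [K, sub_eq_zero]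
    have h1 : ∀ q ∈ G', ∀ k : H, ∀ p ∈ CStarLoc.repGraph π G,
        p ∈ K (itmul π q.1 k, itmul π q.2 k) := by
      intro q hq k
      refine repGraph_le fun p hp l => (hK _ _).2 ?_
      rw [← inner_conj_symm, ← inner_conj_symm (itmul π q.2 k), inner_itmul, inner_itmul,
        h.ip_eq p hp q hq]
    have h2 : q ∈ K p := by
      revert q
      change CStarLoc.repGraph π G' ≤ K p
      refine repGraph_le fun q hq k => (hK _ _).2 ?_
      have := (hK _ _).1 (h1 q hq k p hp)
      rw [← inner_conj_symm, ← inner_conj_symm p.2]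
      exact congrArg _ this.symm
    exact ((hK _ _).1 h2).symm
  dense_left := dense_map_fst_repGraph π h.dense_left
  dense_right := dense_map_fst_repGraph π h.dense_right

variable [PartialOrder A] [StarOrderedRing A]

theorem norm_sq_le_norm_sqAbs (x : A × A) : ‖x‖ ^ 2 ≤ ‖sqAbs x‖ :=
  norm_sq_le_of_quasiState fun _ hφ => hφ.re_le_norm _

omit [PartialOrder A] [StarOrderedRing A] in
theorem norm_sqAbs_le (x : A × A) : ‖sqAbs x‖ ≤ 2 * ‖x‖ ^ 2 := by
  refine (norm_add_le _ _).trans ?_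
  rw [CStarRing.norm_star_mul_self, CStarRing.norm_star_mul_self]
  nlinarith [norm_fst_le x, norm_snd_le x, norm_nonneg x.1, norm_nonneg x.2]

theorem eq_zero_of_sqAbs_eq_zero {x : A × A} (h : sqAbs x = 0) : x = 0 := by
  have := norm_sq_le_norm_sqAbs x
  rw [h, norm_zero] at this
  exact norm_eq_zero.1 (pow_eq_zero_iff two_ne_zero |>.1 (le_antisymm this (sq_nonneg _)))

namespace IsModuleAdjointPair

variable {G G' : Submodule ℂ (A × A)}

theorem norm_le (h : IsModuleAdjointPair G G') {p q : A × A} (hp : p ∈ G) (hq : q ∈ G') :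
    ‖p‖ ≤ 2 * ‖(p.2 + q.1, -p.1 + q.2)‖ ∧ ‖q‖ ≤ 2 * ‖(p.2 + q.1, -p.1 + q.2)‖ := by
  have e := sqAbs_rotate_add (h.ip_eq p hp q hq)
  have h1 := norm_sqAbs_le (p.2 + q.1, -p.1 + q.2)
  rw [e] at h1
  have h2 : ‖sqAbs p‖ ≤ ‖sqAbs p + sqAbs q‖ :=
    CStarAlgebra.norm_le_norm_of_nonneg_of_le (sqAbs_nonneg p)
      (le_add_of_nonneg_right (sqAbs_nonneg q))
  have h3 : ‖sqAbs q‖ ≤ ‖sqAbs p + sqAbs q‖ :=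
    CStarAlgebra.norm_le_norm_of_nonneg_of_le (sqAbs_nonneg q)
      (le_add_of_nonneg_left (sqAbs_nonneg p))
  have h4 := norm_sq_le_norm_sqAbs p
  have h5 := norm_sq_le_norm_sqAbs q
  have h6 := norm_nonneg (p.2 + q.1, -p.1 + q.2)
  constructor <;> refine le_of_sq_le_sq ?_ (by positivity) <;> nlinarith

/-- The orthogonal sum of closed submodules is closed. -/
theorem isClosed_graphSum (h : IsModuleAdjointPair G G') (hG : IsClosed (G : Set (A × A)))
    (hG' : IsClosed (G' : Set (A × A))) : IsClosed (graphSum G G' : Set (A × A)) := by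
  have := hG.completeSpace_coe
  have := hG'.completeSpace_coe
  let f : G × G' →ₗ[ℂ] A × A :=
    ((LinearEquiv.skewSwap ℂ A A).symm.toLinearMap ∘ₗ G.subtype).coprod G'.subtype
  have hf : ∀ x : G × G', f x = ((x.1 : A × A).2 + (x.2 : A × A).1,
      -(x.1 : A × A).1 + (x.2 : A × A).2) := fun x => rfl
  have hcont : UniformContinuous f := by
    have : Continuous f := by
      change Continuous fun x : G × G' => ((x.1 : A × A).2 + (x.2 : A × A).1,
        -(x.1 : A × A).1 + (x.2 : A × A).2)
      fun_prop
    exact (⟨f, this⟩ : G × G' →L[ℂ] A × A).uniformContinuous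
  have hanti : AntilipschitzWith 2 f := by
    refine AddMonoidHomClass.antilipschitz_of_bound f fun x => ?_
    obtain ⟨h1, h2⟩ := h.norm_le x.1.2 x.2.2
    rw [hf, Prod.norm_def x]
    exact max_le h1 h2
  have hr := hanti.isClosed_range hcont
  have heq : (graphSum G G' : Set (A × A)) = Set.range f := by
    ext s
    rw [SetLike.mem_coe, mem_graphSum, Set.mem_range]
    simp only [hf]
    refine ⟨?_, ?_⟩
    · rintro ⟨p, hp, q, hq, rfl⟩
      exact ⟨(⟨p, hp⟩, ⟨q, hq⟩), rfl⟩
    · rintro ⟨x, rfl⟩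
      exact ⟨x.1, x.1.2, x.2, x.2.2, rfl⟩
  rwa [heq]

theorem graphSum_eq_top (h : IsModuleAdjointPair G G') (hG : IsClosed (G : Set (A × A)))
    (hG' : IsClosed (G' : Set (A × A))) (hd : Dense (graphSum G G' : Set (A × A))) :
    graphSum G G' = ⊤ := by
  rw [← Submodule.dense_iff_topologicalClosure_eq_top.1 hd,
    (h.isClosed_graphSum hG hG').submodule_topologicalClosure_eq]

theorem state (h : IsModuleAdjointPair G G') (ω : A →ₚ[ℂ] ℂ) :
    IsFormalAdjointPair (G.map ((iota ω).prodMap (iota ω)))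
      (G'.map ((iota ω).prodMap (iota ω))) where
  inner_eq := by
    rintro _ ⟨p, hp, rfl⟩ _ ⟨q, hq, rfl⟩
    change ⟪iota ω p.2, iota ω q.1⟫_ℂ = ⟪iota ω p.1, iota ω q.2⟫_ℂ
    rw [inner_iota, inner_iota, h.ip_eq p hp q hq]
  dense_left := by
    rw [← Submodule.map_comp, show LinearMap.fst ℂ _ _ ∘ₗ (iota ω).prodMap (iota ω) =
      iota ω ∘ₗ LinearMap.fst ℂ A A from rfl, Submodule.map_comp]
    exact dense_map_iota ω h.dense_left
  dense_right := by
    rw [← Submodule.map_comp, show LinearMap.fst ℂ _ _ ∘ₗ (iota ω).prodMap (iota ω) =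
      iota ω ∘ₗ LinearMap.fst ℂ A A from rfl, Submodule.map_comp]
    exact dense_map_iota ω h.dense_right

end IsModuleAdjointPair

theorem gns_apply_iota (ω : A →ₚ[ℂ] ℂ) (a b : A) :
    ω.gnsNonUnitalStarAlgHom a (iota ω b) = iota ω (a * b) :=
  PositiveLinearMap.gnsNonUnitalStarAlgHom_apply_coe ω (b := ω.toPreGNS b)

/-- The range contains all `ι_ω(a b)`, and an approximate unit shows that these are dense. -/
theorem denseRange_intTensorEval_gns (ω : A →ₚ[ℂ] ℂ) :
    DenseRange (intTensorEval ω.gnsNonUnitalStarAlgHom) := by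
  intro ξ
  have hK : ∀ a b : A, iota ω (a * b) ∈
      closure (Set.range (intTensorEval ω.gnsNonUnitalStarAlgHom)) := fun a b =>
    subset_closure ⟨itmul _ a (iota ω b), by rw [intTensorEval_itmul, gns_apply_iota]⟩
  refine (denseRange_iota ω).induction_on ξ isClosed_closure fun x => ?_
  have hu := CStarAlgebra.increasingApproximateUnit A
  have ht := hu.toIsApproximateUnit.tendsto_mul_right x
  have := hu.toIsApproximateUnit.neBot
  exact isClosed_closure.mem_of_tendsto (((continuous_iota ω).tendsto x).comp ht)
    (Filter.Eventually.of_forall fun e => hK _ _)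

/-- Density in the interior tensor product with the GNS representation implies density in the
localization at the state. -/
theorem dense_map_iota_of_dense_repGraph_gns (ω : A →ₚ[ℂ] ℂ) {S : Submodule ℂ (A × A)}
    (hS : IsRightInvariant S) (hd : Dense (repGraph ω.gnsNonUnitalStarAlgHom S :
      Set (IntTensor ω.gnsNonUnitalStarAlgHom × IntTensor ω.gnsNonUnitalStarAlgHom))) :
    Dense (S.map ((iota ω).prodMap (iota ω)) : Set (ω.GNS × ω.GNS)) := by
  set π := ω.gnsNonUnitalStarAlgHom
  let V := intTensorEval π
  have hV : DenseRange V := denseRange_intTensorEval_gns ω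
  have h1 := (hV.prodMap hV).dense_image (V.continuous.prodMap V.continuous) hd
  refine Dense.of_closure (h1.mono ?_)
  rw [Set.image_subset_iff]
  let K : Submodule ℂ (IntTensor π × IntTensor π) :=
    (S.map ((iota ω).prodMap (iota ω))).topologicalClosure.comap
      (V.toLinearMap.prodMap V.toLinearMap)
  change repGraph π S ≤ K
  refine repGraph_le fun s hs h => ?_
  change (V (itmul π s.1 h), V (itmul π s.2 h)) ∈
    closure (S.map ((iota ω).prodMap (iota ω)) : Set (ω.GNS × ω.GNS))
  have e : (V (itmul π s.1 h), V (itmul π s.2 h)) = (π s.1 h, π s.2 h) :=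
    Prod.ext (intTensorEval_itmul π _ _) (intTensorEval_itmul π _ _)
  rw [e]
  -- It suffices to take `h = ι_ω(b)`, where right invariance puts `(s.1 * b, s.2 * b)` back into
  -- `S`.
  refine map_mem_closure (f := fun h => (π s.1 h, π s.2 h)) (by fun_prop)
    (denseRange_iota ω h) ?_
  rintro _ ⟨b, rfl⟩
  refine ⟨(s.1 * b, s.2 * b), hS s hs b, ?_⟩
  change (iota ω (s.1 * b), iota ω (s.2 * b)) = (π s.1 (iota ω b), π s.2 (iota ω b))
  rw [gns_apply_iota, gns_apply_iota]

/-- Density of the sum of graphs can be tested in the localizations. -/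
theorem IsModuleAdjointPair.tfae_dense {A : Type u} [NonUnitalCStarAlgebra A] [PartialOrder A]
    [StarOrderedRing A] {G G' : Submodule ℂ (A × A)}
    (h : IsModuleAdjointPair G G') (hG : IsRightInvariant G) (hG' : IsRightInvariant G') :
    List.TFAE [
      Dense (graphSum G G' : Set (A × A)),
      ∀ (H : Type u) [NormedAddCommGroup H] [InnerProductSpace ℂ H] [CompleteSpace H]
        (π : A →⋆ₙₐ[ℂ] (H →L[ℂ] H)),
        (CStarLoc.repGraph π G).toLinearPMap.closure.adjoint =
          (CStarLoc.repGraph π G').toLinearPMap.closure,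
      ∀ ω : A →ₚ[ℂ] ℂ, IsPureState ω →
        (G.map ((iota ω).prodMap (iota ω))).toLinearPMap.closure.adjoint =
          (G'.map ((iota ω).prodMap (iota ω))).toLinearPMap.closure] := by
  have hS := isRightInvariant_graphSum hG hG'
  tfae_have 1 → 2 := by
    intro hd H _ _ _ π
    rw [(h.repGraph π).adjoint_closure_eq_iff, ← repGraph_graphSum]
    exact dense_repGraph π hd
  -- The given property is applied to the GNS representation of `ω`.
  tfae_have 2 → 3 := by
    intro h2 ω _
    rw [(h.state ω).adjoint_closure_eq_iff, ← map_graphSum]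
    refine dense_map_iota_of_dense_repGraph_gns ω hS ?_
    rw [repGraph_graphSum, ← (h.repGraph _).adjoint_closure_eq_iff]
    exact h2 _ _
  tfae_have 3 → 1 := by
    intro h3
    refine dense_of_forall_pureState hS fun ω hω => ?_
    rw [map_graphSum, ← (h.state ω).adjoint_closure_eq_iff]
    exact h3 ω hω
  tfae_finish

end ModulePairs

/-! ### Regularity and selfadjointness through graph sums. -/

section Operators

variable {A : Type*} [NonUnitalCStarAlgebra A] {T : A →ₗ.[ℂ] A}

theorem graph_adj (hT : Dense (T.domain : Set A)) : (adj T).graph = adjointGraph T :=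
  Submodule.toLinearPMap_graph_eq _ fun p => mem_adjointGraph_fst_eq_zero hT p

theorem isClosed_adjointGraph (T : A →ₗ.[ℂ] A) : IsClosed (adjointGraph T : Set (A × A)) := by
  have : (adjointGraph T : Set (A × A)) = ⋂ x : T.domain,
      {p : A × A | star (T x) * p.1 = star (x : A) * p.2} := by
    ext p
    simp only [Set.mem_iInter]
    rfl
  rw [this]
  exact isClosed_iInter fun x => isClosed_eq (by fun_prop) (by fun_prop)

theorem isRightInvariant_adjointGraph (T : A →ₗ.[ℂ] A) : IsRightInvariant (adjointGraph T) := by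
  intro p hp a x
  have := hp x
  simp only [ip] at this ⊢
  rw [← mul_assoc, this, mul_assoc]

theorem ip_eq_of_mem_adjointGraph {p q : A × A} (hp : p ∈ T.graph) (hq : q ∈ adjointGraph T) :
    ip p.2 q.1 = ip p.1 q.2 := by
  obtain ⟨x, h1, h2⟩ := (T.mem_graph_iff).1 hp
  rw [← h1, ← h2]
  exact hq x

theorem eq_of_star_mul_eq {D : Set A} (hD : Dense D) {a b : A}
    (h : ∀ y ∈ D, star a * y = star b * y) : a = b := by
  have h1 : star (a - b) * (a - b) = 0 := by
    refine hD.induction (P := fun y => star (a - b) * y = 0) (fun y hy => ?_)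
      (isClosed_eq (by fun_prop) continuous_const) (a - b)
    rw [star_sub, sub_mul, h y hy, sub_self]
  exact sub_eq_zero.1 ((CStarRing.star_mul_self_eq_zero_iff _).1 h1)

/-- `T` is assumed only `ℂ`-linear; its `A`-linearity follows by pairing with the dense domain of
`T*`. -/
theorem IsSemiregular.isRightInvariant_graph (hT : IsSemiregular T) :
    IsRightInvariant T.graph := by
  intro p hp a
  obtain ⟨x, h1, h2⟩ := (T.mem_graph_iff).1 hp
  refine (T.mem_graph_iff).2 ⟨⟨x * a, hT.submodule x x.2 a⟩, by simp [h1], ?_⟩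
  refine eq_of_star_mul_eq hT.dense_adj fun y hy => ?_
  have key := (mem_graph_adj hT.dense y (adj T ⟨y, hy⟩)).1 ((adj T).mem_graph ⟨y, hy⟩)
  have e1 := key ⟨x * a, hT.submodule x x.2 a⟩
  have e2 := key x
  simp only [ip, star_mul] at e1 e2
  rw [e1, ← h2, star_mul, mul_assoc, mul_assoc, e2]

theorem graph_map_fst_coe (T : A →ₗ.[ℂ] A) :
    (T.graph.map (LinearMap.fst ℂ A A) : Set A) = T.domain := by
  rw [LinearPMap.graph_map_fst_eq_domain]

theorem IsSemiregular.isModuleAdjointPair (hT : IsSemiregular T) :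
    IsModuleAdjointPair T.graph (adj T).graph where
  ip_eq p hp q hq := ip_eq_of_mem_adjointGraph hp (graph_adj hT.dense ▸ hq)
  dense_left := by
    rw [graph_map_fst_coe]
    exact hT.dense
  dense_right := by
    rw [graph_map_fst_coe]
    exact hT.dense_adj

theorem IsSemiregular.isModuleAdjointPair_self (hT : IsSemiregular T) (hs : T ≤ adj T) :
    IsModuleAdjointPair T.graph T.graph :=
  ⟨fun p hp q hq => hT.isModuleAdjointPair.ip_eq p hp q (LinearPMap.le_graph_of_le hs hq),
    hT.isModuleAdjointPair.dense_left, hT.isModuleAdjointPair.dense_left⟩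

theorem mem_graphSum_of_mem_rangeOneAdd {w : A} (hw : w ∈ rangeOneAdd T) :
    ((0 : A), -w) ∈ graphSum T.graph (adj T).graph := by
  obtain ⟨x, hx, rfl⟩ := hw
  refine mem_graphSum.2 ⟨_, T.mem_graph x, _, neg_mem ((adj T).mem_graph ⟨T x, hx⟩), ?_⟩
  simp [add_comm]

/-- The closure contains `0 × A`; subtracting this from the graph of `T*` yields `dom T* × 0`, hence
also `A × 0`. -/
theorem dense_graphSum_of_dense_rangeOneAdd (hT : IsSemiregular T)
    (h : Dense (rangeOneAdd T)) : Dense (graphSum T.graph (adj T).graph : Set (A × A)) := by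
  set S := graphSum T.graph (adj T).graph with hS
  have h1 : ∀ a : A, ((0 : A), a) ∈ S.topologicalClosure := by
    intro a
    change _ ∈ closure (S : Set (A × A))
    have := map_mem_closure (f := fun a : A => ((0 : A), -a)) (t := (S : Set (A × A)))
      (by fun_prop) (h (-a)) fun w hw => mem_graphSum_of_mem_rangeOneAdd hw
    simpa using this
  have h2 : ∀ a : A, (a, (0 : A)) ∈ S.topologicalClosure := by
    intro a
    refine hT.dense_adj.induction (P := fun a : A => (a, (0 : A)) ∈ S.topologicalClosure)
      (fun y hy => ?_) (S.isClosed_topologicalClosure.preimage (by fun_prop)) a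
    have hy' : (y, adj T ⟨y, hy⟩) ∈ S.topologicalClosure :=
      S.le_topologicalClosure (Submodule.mem_sup_right ((adj T).mem_graph ⟨y, hy⟩))
    simpa using sub_mem hy' (h1 (adj T ⟨y, hy⟩))
  intro x
  change x ∈ S.topologicalClosure
  simpa using add_mem (h2 x.1) (h1 x.2)

theorem rangeOneAdd_eq_univ (h : graphSum T.graph (adj T).graph = ⊤) :
    rangeOneAdd T = Set.univ := by
  refine Set.eq_univ_of_forall fun w => ?_
  have hw : ((0 : A), -w) ∈ graphSum T.graph (adj T).graph := h ▸ Submodule.mem_top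
  obtain ⟨p, hp, q, hq, e⟩ := mem_graphSum.1 hw
  obtain ⟨x, h1, h2⟩ := (T.mem_graph_iff).1 hp
  obtain ⟨y, h3, h4⟩ := ((adj T).mem_graph_iff).1 hq
  have e1 : p.2 + q.1 = 0 := congrArg Prod.fst e
  have e2 : -p.1 + q.2 = -w := congrArg Prod.snd e
  have hTx : T x = ((-y : (adj T).domain) : A) := by
    rw [h2, Submodule.coe_neg, h3]
    exact eq_neg_of_add_eq_zero_left e1
  have hx : T x ∈ (adj T).domain := hTx ▸ (-y).2
  refine ⟨x, hx, ?_⟩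
  have : (⟨T x, hx⟩ : (adj T).domain) = -y := Subtype.ext hTx
  rw [this, LinearPMap.map_neg, h4, h1, ← neg_neg w, ← e2]
  abel

theorem isClosed_graph_adj (hT : Dense (T.domain : Set A)) :
    IsClosed ((adj T).graph : Set (A × A)) := by
  rw [graph_adj hT]
  exact isClosed_adjointGraph T

theorem IsDenselyDefined.isSemiregular_of_le (hT : IsDenselyDefined T) (hs : T ≤ adj T) :
    IsSemiregular T :=
  ⟨hT, hT.dense.mono hs.1⟩

variable [PartialOrder A] [StarOrderedRing A]

/-- A closed semiregular operator is regular iff its graph is orthogonally complemented. -/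
theorem isRegular_iff_dense_graphSum (hT : IsSemiregular T) (hc : T.IsClosed) :
    IsRegular T ↔ Dense (graphSum T.graph (adj T).graph : Set (A × A)) := by
  refine ⟨fun h => dense_graphSum_of_dense_rangeOneAdd hT h.dense_range, fun h => ⟨hT, hc, ?_⟩⟩
  rw [rangeOneAdd_eq_univ
    (hT.isModuleAdjointPair.graphSum_eq_top hc (isClosed_graph_adj hT.dense) h)]
  exact dense_univ

/-- If the sum is dense it is everything. A vector of the graph of `T*`, minus its component in the
graph of `T`, lies in the rotated graph and is orthogonal to itself, so `T* = T`. -/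
theorem selfAdjoint_isRegular_iff_dense_graphSum (hT : IsDenselyDefined T) (hc : T.IsClosed)
    (hs : T ≤ adj T) :
    (adj T = T ∧ IsRegular T) ↔ Dense (graphSum T.graph T.graph : Set (A × A)) := by
  have hsr := hT.isSemiregular_of_le hs
  constructor
  · rintro ⟨h1, h2⟩
    have := (isRegular_iff_dense_graphSum hsr hc).1 h2
    rwa [h1] at this
  · intro h
    have hle : T.graph ≤ (adj T).graph := LinearPMap.le_graph_of_le hs
    have hpair := hsr.isModuleAdjointPair_self hs
    have htop := hpair.graphSum_eq_top hc hc h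
    have hadj : adj T = T := by
      refine LinearPMap.eq_of_eq_graph (le_antisymm (fun r hr => ?_) hle)
      obtain ⟨p, hp, q, hq, e⟩ := mem_graphSum.1 (htop ▸ Submodule.mem_top : r ∈ graphSum _ _)
      have hrq : (p.2, -p.1) ∈ (adj T).graph := by
        have := sub_mem hr (hle hq)
        rwa [← e, show ((p.2 + q.1, -p.1 + q.2) : A × A) - q = (p.2, -p.1) from
          Prod.ext (add_sub_cancel_right _ _) (add_sub_cancel_right _ _)] at this
      have h0 := hsr.isModuleAdjointPair.ip_eq p hp _ hrq
      have h1 : sqAbs p = 0 := by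
        simp only [ip, mul_neg] at h0
        rw [sqAbs, h0, add_neg_cancel]
      have h2 := eq_zero_of_sqAbs_eq_zero h1
      subst h2
      rw [← e]
      simpa using hq
    refine ⟨hadj, (isRegular_iff_dense_graphSum hsr hc).2 ?_⟩
    rwa [hadj]

end Operators

/-! ### Localizations as closures of graphs, and the final assembly. -/

theorem locState_eq {A : Type*} [NonUnitalCStarAlgebra A] [PartialOrder A] [StarOrderedRing A]
    (ω : A →ₚ[ℂ] ℂ) (T : A →ₗ.[ℂ] A) :
    locState ω T = (T.graph.map ((iota ω).prodMap (iota ω))).toLinearPMap.closure := rfl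

theorem locRep_eq {A : Type*} [NonUnitalCStarAlgebra A] {H : Type*} [NormedAddCommGroup H]
    [InnerProductSpace ℂ H] [CompleteSpace H] (π : A →⋆ₙₐ[ℂ] (H →L[ℂ] H)) (T : A →ₗ.[ℂ] A) :
    locRep π T = (repGraph π T.graph).toLinearPMap.closure := by
  rw [locRep, preLocRep_eq]

end CStarLoc
end

theorem theorem5 {A : Type u} [NonUnitalCStarAlgebra A] [PartialOrder A] [StarOrderedRing A] :
    -- separation of proper closed submodules by pure states
    (∀ L : Submodule ℂ A, CStarLoc.IsRightSubmodule L → IsClosed (L : Set A) → L ≠ ⊤ →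
      ∃ ω : A →ₚ[ℂ] ℂ, CStarLoc.IsPureState ω ∧
        ¬ Dense (CStarLoc.iota ω '' (L : Set A)) ∧
        (L.map (CStarLoc.iota ω))ᗮ ≠ ⊥) ∧
    -- local-global principle for closed semiregular operators
    (∀ T : A →ₗ.[ℂ] A, CStarLoc.IsSemiregular T → T.IsClosed →
      List.TFAE [
        CStarLoc.IsRegular T,
        ∀ (H : Type u) [NormedAddCommGroup H] [InnerProductSpace ℂ H] [CompleteSpace H]
          (π : A →⋆ₙₐ[ℂ] (H →L[ℂ] H)),
          CStarLoc.locRep π (CStarLoc.adj T) = (CStarLoc.locRep π T).adjoint,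
        ∀ ω : A →ₚ[ℂ] ℂ, CStarLoc.IsPureState ω →
          CStarLoc.locState ω (CStarLoc.adj T) = (CStarLoc.locState ω T).adjoint]) ∧
    -- local-global principle for closed, densely defined, symmetric operators
    (∀ T : A →ₗ.[ℂ] A, CStarLoc.IsDenselyDefined T → T.IsClosed → T ≤ CStarLoc.adj T →
      List.TFAE [
        CStarLoc.adj T = T ∧ CStarLoc.IsRegular T,
        ∀ (H : Type u) [NormedAddCommGroup H] [InnerProductSpace ℂ H] [CompleteSpace H]
          (π : A →⋆ₙₐ[ℂ] (H →L[ℂ] H)),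
          (CStarLoc.locRep π T).adjoint = CStarLoc.locRep π T,
        ∀ ω : A →ₚ[ℂ] ℂ, CStarLoc.IsPureState ω →
          (CStarLoc.locState ω T).adjoint = CStarLoc.locState ω T]) := by
  refine ⟨fun L hL hcl hne => ?_, fun T hT hc => ?_, fun T hT hc hs => ?_⟩
  · obtain ⟨ω, hω, hd⟩ := CStarLoc.exists_pureState_not_dense hL hcl hne
    refine ⟨ω, hω, hd, fun h0 => hd ?_⟩
    rw [← Submodule.topologicalClosure_eq_top_iff,
      ← Submodule.dense_iff_topologicalClosure_eq_top] at h0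
    exact h0
  · have hadj : CStarLoc.IsRightInvariant (CStarLoc.adj T).graph := by
      rw [CStarLoc.graph_adj hT.dense]
      exact CStarLoc.isRightInvariant_adjointGraph T
    have := hT.isModuleAdjointPair.tfae_dense hT.isRightInvariant_graph hadj
    rw [← CStarLoc.isRegular_iff_dense_graphSum hT hc] at this
    simp only [CStarLoc.locRep_eq, CStarLoc.locState_eq]
    simp only [eq_comm (b := LinearPMap.adjoint _)]
    exact this
  · have hsr := hT.isSemiregular_of_le hs
    have hpair : CStarLoc.IsModuleAdjointPair T.graph T.graph :=
      hsr.isModuleAdjointPair_self hs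
    have := hpair.tfae_dense hsr.isRightInvariant_graph hsr.isRightInvariant_graph
    rw [← CStarLoc.selfAdjoint_isRegular_iff_dense_graphSum hT hc hs] at this
    simp only [CStarLoc.locRep_eq, CStarLoc.locState_eq]
    exact this
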